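/- Let $n,k\ge 0$ and let $F:\Sigma\to\mathbb{R}^{n+k}$ be a smooth immersion of a smooth, noncompact, oriented $n$-dimensional manifold $\Sigma$ without boundary (Hausdorff and second countable; connectedness is not required). Give $\Sigma$ the Riemannian metric $g$ induced by $F$, and let $\mu$ be its Riemannian volume measure. Assume that: (i) $\Sigma$ is complete as a metric space with the intrinsic distance of $g$ (the infimum of the lengths of curves in $\Sigma$, equal to $+\infty$ between different components); (ii) $\Sigma$ has finite entropy, $$\lambda(\Sigma)=\sup_{x_0\in\mathbb{R}^{n+k},\ t_0>0}\ \frac{1}{(4\pi t_0)^{n/2}}\int_\Sigma e^{-\frac{\|F(p)-x_0\|^2}{4t_0}}\,d\mu(p)<\infty;$$ (iii) the mean curvature vector $H$ of $F$, i.e. the trace with respect to $g$ of the second fundamental form, is bounded: there is a constant $C>0$ with $|H|\le C$ on $\Sigma$. Then $\Sigma$ is properly immersed, i.e. $F$ is a proper map: the preimage under $F$ of every compact subset of $\mathbb{R}^{n+k}$ is compact. -/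

import Mathlib

open Set MeasureTheory Bundle
open scoped Manifold ContDiff ENNReal Topology

noncomputable section

namespace Immersed

/-- `M` is orientable: it admits a family of charts of its smooth structure that covers `M` and
all of whose coordinate changes have positive Jacobian determinant. -/
def IsOrientable (n : ℕ) (M : Type*) [TopologicalSpace M]
    [ChartedSpace (EuclideanSpace ℝ (Fin n)) M] : Prop :=
  ∃ A : Set (OpenPartialHomeomorph M (EuclideanSpace ℝ (Fin n))),
    A ⊆ IsManifold.maximalAtlas (𝓡 n) ∞ M ∧
    (∀ x : M, ∃ e ∈ A, x ∈ e.source) ∧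
    ∀ e ∈ A, ∀ e' ∈ A, ∀ u ∈ (e.symm.trans e').source,
      0 < (fderiv ℝ (fun v => e' (e.symm v)) u).det

/-- `F : M → ℝᵐ` is a smooth isometric immersion of the Riemannian manifold `M`: it is smooth and
the Riemannian metric of `M` is the one induced by `F`, that is `⟪dF v, dF w⟫ = g (v, w)`.
(Since `g` is positive definite, `dF` is then injective.) -/
def IsIsometricImmersion (n : ℕ) {m : ℕ} {M : Type*} [TopologicalSpace M]
    [ChartedSpace (EuclideanSpace ℝ (Fin n)) M]
    [RiemannianBundle (fun x : M => TangentSpace (𝓡 n) x)]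
    (F : M → EuclideanSpace ℝ (Fin m)) : Prop :=
  ContMDiff (𝓡 n) (𝓡 m) ∞ F ∧
  ∀ (x : M) (v w : TangentSpace (𝓡 n) x),
    inner ℝ (mfderiv (𝓡 n) (𝓡 m) F x v : EuclideanSpace ℝ (Fin m))
      (mfderiv (𝓡 n) (𝓡 m) F x w : EuclideanSpace ℝ (Fin m)) = inner ℝ v w

/-- The map `F` read in the chart of `M` at `x`: a local parametrization of the immersed
submanifold, defined on the open set `(extChartAt (𝓡 n) x).target`. -/
def localParam (n : ℕ) {m : ℕ} {M : Type*} [TopologicalSpace M]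
    [ChartedSpace (EuclideanSpace ℝ (Fin n)) M]
    (F : M → EuclideanSpace ℝ (Fin m)) (x : M) :
    EuclideanSpace ℝ (Fin n) → EuclideanSpace ℝ (Fin m) :=
  fun u => F ((extChartAt (𝓡 n) x).symm u)

/-- The `i`-th partial derivative `∂ᵢ f`. -/
def partialDeriv {n m : ℕ} (f : EuclideanSpace ℝ (Fin n) → EuclideanSpace ℝ (Fin m)) (i : Fin n)
    (u : EuclideanSpace ℝ (Fin n)) : EuclideanSpace ℝ (Fin m) :=
  fderiv ℝ f u (EuclideanSpace.single i 1)

/-- The matrix `gᵢⱼ = ⟪∂ᵢ f, ∂ⱼ f⟫` of the metric induced by a local parametrization `f`. -/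
def inducedMetric {n m : ℕ} (f : EuclideanSpace ℝ (Fin n) → EuclideanSpace ℝ (Fin m))
    (u : EuclideanSpace ℝ (Fin n)) : Matrix (Fin n) (Fin n) ℝ :=
  Matrix.of fun i j => inner ℝ (partialDeriv f i u) (partialDeriv f j u)

/-- The mean curvature vector `H = gⁱʲ (∂ᵢ ∂ⱼ f)^⊥` of a local parametrization `f`, the trace of
the second fundamental form; `^⊥` is the orthogonal projection to the normal space
`(range df)ᗮ`. -/
def localMeanCurvature {n m : ℕ} (f : EuclideanSpace ℝ (Fin n) → EuclideanSpace ℝ (Fin m))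
    (u : EuclideanSpace ℝ (Fin n)) : EuclideanSpace ℝ (Fin m) :=
  ∑ i, ∑ j, (inducedMetric f u)⁻¹ i j •
    (LinearMap.range (fderiv ℝ f u).toLinearMap)ᗮ.starProjection
      (partialDeriv (partialDeriv f j) i u)

/-- The mean curvature vector of the immersion `F` at `x`. -/
def meanCurvature (n : ℕ) {m : ℕ} {M : Type*} [TopologicalSpace M]
    [ChartedSpace (EuclideanSpace ℝ (Fin n)) M]
    (F : M → EuclideanSpace ℝ (Fin m)) (x : M) : EuclideanSpace ℝ (Fin m) :=
  localMeanCurvature (localParam n F x) (extChartAt (𝓡 n) x x)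

/-- The area measure of the immersion `F` on the domain of the chart at `x` (and zero outside):
the measure with density `√(det g)` with respect to Lebesgue measure in the chart. -/
def chartArea (n : ℕ) {m : ℕ} {M : Type*} [TopologicalSpace M]
    [ChartedSpace (EuclideanSpace ℝ (Fin n)) M] [MeasurableSpace M]
    (F : M → EuclideanSpace ℝ (Fin m)) (x : M) : Measure M :=
  (((volume : Measure (EuclideanSpace ℝ (Fin n))).restrict (extChartAt (𝓡 n) x).target).withDensity
    fun u => ENNReal.ofReal √(inducedMetric (localParam n F x) u).det).map
      (extChartAt (𝓡 n) x).symm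

/-- The `n`-dimensional area measure on `M` of the immersion `F`. The measures `chartArea n F x` agree
where chart domains overlap, and their supremum in the lattice of measures is the one measure that
restricts to each of them: the Riemannian volume measure of the induced metric. Sheets of the
immersed submanifold are counted with multiplicity, since the measure lives on `M`. -/
def area (n : ℕ) {m : ℕ} {M : Type*} [TopologicalSpace M]
    [ChartedSpace (EuclideanSpace ℝ (Fin n)) M] [MeasurableSpace M]
    (F : M → EuclideanSpace ℝ (Fin m)) : Measure M :=
  ⨆ x : M, chartArea n F x

/-- The functional
`F_{x₀,t₀} = (4 π t₀)^(-n/2) ∫_M exp (-‖F p - x₀‖² / (4 t₀)) dμ(p)`, with values in `[0, ∞]`. -/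
def gaussianArea (n : ℕ) {m : ℕ} {M : Type*} [TopologicalSpace M]
    [ChartedSpace (EuclideanSpace ℝ (Fin n)) M] [MeasurableSpace M]
    (F : M → EuclideanSpace ℝ (Fin m)) (x₀ : EuclideanSpace ℝ (Fin m)) (t₀ : ℝ) : ℝ≥0∞ :=
  ENNReal.ofReal ((4 * Real.pi * t₀) ^ (-(n : ℝ) / 2)) *
    ∫⁻ p, ENNReal.ofReal (Real.exp (-‖F p - x₀‖ ^ 2 / (4 * t₀))) ∂(area n F)

/-- The entropy `λ = sup_{x₀, t₀ > 0} F_{x₀,t₀}`, with values in `[0, ∞]`. -/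
def entropy (n : ℕ) {m : ℕ} {M : Type*} [TopologicalSpace M]
    [ChartedSpace (EuclideanSpace ℝ (Fin n)) M] [MeasurableSpace M]
    (F : M → EuclideanSpace ℝ (Fin m)) : ℝ≥0∞ :=
  ⨆ (x₀ : EuclideanSpace ℝ (Fin m)) (t₀ : ℝ) (_ : 0 < t₀), gaussianArea n F x₀ t₀

end Immersed

end

/-! The argument is a packing argument. If the preimage of a compact set `K` were not compact, then,
being closed in a complete space, it would fail to be totally bounded and would contain an infinite
`δ`-separated sequence for the intrinsic distance. The intrinsic balls of radius `δ / 2` about its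
points are disjoint, and since `F` is `1`-Lipschitz they all map into one bounded set. That set has
a preimage of finite area, because the Gaussian weight of a single centre and scale is bounded below
on it (`area_preimage_closedBall_lt_top`). So a lower bound for the area of intrinsic balls of fixed
radius, uniform in the centre, gives a contradiction.

The lower bound (`exists_le_measure_closedEBall`) is a monotonicity formula with intrinsic distance.
Put `X = F - F p`, `ρ` the distance to `p`, `μ = (s - ρ)₊` and `J s = ∫ μ²`. The tangential part of
`X` has divergence `n + ⟪H, X⟫` (`sum_fderiv_tangentCoord`), so testing with `μ²` gives `∫ (n + ⟪H,
X⟫) μ² + d(μ²)(Xᵀ) = 0` (`integral_firstVariation`). Where `μ > 0`, the bounds `‖X‖ ≤ ρ < s`, `|∇ρ|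
≤ 1` and `‖H‖ ≤ C` yield `(n + 2 - C s) J ≤ s J'`; hence `exp (C s) J s / s ^ (n + 2)` is
nondecreasing. For small `s` it is bounded below by a constant independent of `p`, by comparison
with Euclidean volume (`eventually_le_measure_eball`).

Two points need care. The cutoff must have compact support, which follows from Hopf–Rinow
(`isCompact_closedEBall_of_length`). And `ρ` is only Lipschitz, so the divergence theorem is proved
for Lipschitz test functions: Rademacher's theorem and integration by parts in charts, invariance of
the integrand under change of chart, and a partition of unity. -/

noncomputable section

namespace Immersed

/-! ### Linear algebra of the induced metric and the tangential projection. -/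

section LocalCalculus

variable {n m : ℕ} {f : EuclideanSpace ℝ (Fin n) → EuclideanSpace ℝ (Fin m)}
  {u : EuclideanSpace ℝ (Fin n)}

lemma map_eq_sum_single {W : Type*} [AddCommGroup W] [Module ℝ W] [TopologicalSpace W]
    (L : EuclideanSpace ℝ (Fin n) →L[ℝ] W) (v : EuclideanSpace ℝ (Fin n)) :
    L v = ∑ i, v i • L (EuclideanSpace.single i 1) := by
  conv_lhs => rw [← (EuclideanSpace.basisFun (Fin n) ℝ).sum_repr v]
  simp [map_sum, map_smul]

lemma inner_fderiv_eq (v w : EuclideanSpace ℝ (Fin n)) :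
    inner ℝ (fderiv ℝ f u v) (fderiv ℝ f u w) =
      v.ofLp ⬝ᵥ (inducedMetric f u).mulVec w.ofLp := by
  rw [map_eq_sum_single _ v, map_eq_sum_single _ w]
  simp only [sum_inner, inner_sum, real_inner_smul_left, real_inner_smul_right, dotProduct,
    Matrix.mulVec, inducedMetric, partialDeriv, Matrix.of_apply, Finset.mul_sum]
  rw [Finset.sum_comm]
  exact Finset.sum_congr rfl fun i _ => Finset.sum_congr rfl fun j _ => by ring

lemma inducedMetric_isHermitian : (inducedMetric f u).IsHermitian := by
  ext i j
  simp [inducedMetric, real_inner_comm]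

lemma inducedMetric_posDef (h : Function.Injective (fderiv ℝ f u)) :
    (inducedMetric f u).PosDef := by
  refine Matrix.PosDef.of_dotProduct_mulVec_pos inducedMetric_isHermitian fun v hv => ?_
  have := inner_fderiv_eq (f := f) (u := u) (WithLp.toLp 2 v) (WithLp.toLp 2 v)
  simp only [star_trivial]
  rw [← this]
  refine real_inner_self_pos.2 fun h0 => hv ?_
  have := h (h0.trans (map_zero _).symm)
  simpa using this

lemma inducedMetric_det_pos (h : Function.Injective (fderiv ℝ f u)) :
    0 < (inducedMetric f u).det := (inducedMetric_posDef h).det_pos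

/-- The coordinates of the tangential part of the vector `X` along `f`. -/
def tangentCoord (f : EuclideanSpace ℝ (Fin n) → EuclideanSpace ℝ (Fin m))
    (u : EuclideanSpace ℝ (Fin n)) (X : EuclideanSpace ℝ (Fin m)) : EuclideanSpace ℝ (Fin n) :=
  WithLp.toLp 2 ((inducedMetric f u)⁻¹.mulVec fun j => inner ℝ X (partialDeriv f j u))

/-- These are the normal equations `G ξ = (⟪X, ∂ⱼ f⟫)ⱼ` of the orthogonal projection to the tangent
space, solved by `G⁻¹`. -/
lemma inner_fderiv_tangentCoord (h : Function.Injective (fderiv ℝ f u))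
    (X : EuclideanSpace ℝ (Fin m)) (w : EuclideanSpace ℝ (Fin n)) :
    inner ℝ (fderiv ℝ f u (tangentCoord f u X)) (fderiv ℝ f u w) =
      inner ℝ X (fderiv ℝ f u w) := by
  have hu : IsUnit (inducedMetric f u).det := (inducedMetric_det_pos h).ne'.isUnit
  rw [real_inner_comm, inner_fderiv_eq, tangentCoord, Matrix.mulVec_mulVec,
    Matrix.mul_nonsing_inv _ hu, Matrix.one_mulVec, map_eq_sum_single _ w, inner_sum]
  simp [dotProduct, real_inner_smul_right, partialDeriv]

/-- Uniqueness in the normal equations; it later gives chart independence without computing with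
inverse matrices. -/
lemma eq_tangentCoord (h : Function.Injective (fderiv ℝ f u))
    {X : EuclideanSpace ℝ (Fin m)} {ξ : EuclideanSpace ℝ (Fin n)}
    (hξ : ∀ w, inner ℝ (fderiv ℝ f u ξ) (fderiv ℝ f u w) = inner ℝ X (fderiv ℝ f u w)) :
    ξ = tangentCoord f u X := by
  have h1 : ∀ w, inner ℝ (fderiv ℝ f u (ξ - tangentCoord f u X)) (fderiv ℝ f u w) = 0 := by
    intro w
    rw [map_sub, inner_sub_left, hξ, inner_fderiv_tangentCoord h, sub_self]
  have h2 := inner_self_eq_zero.1 (h1 (ξ - tangentCoord f u X))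
  exact sub_eq_zero.1 (h (h2.trans (map_zero _).symm))

lemma starProjection_range_orthogonal (h : Function.Injective (fderiv ℝ f u))
    (X : EuclideanSpace ℝ (Fin m)) :
    (LinearMap.range (fderiv ℝ f u).toLinearMap)ᗮ.starProjection X =
      X - fderiv ℝ f u (tangentCoord f u X) := by
  rw [Submodule.starProjection_orthogonal_val]
  congr 1
  refine Submodule.eq_starProjection_of_mem_of_inner_eq_zero ⟨_, rfl⟩ ?_
  rintro _ ⟨w, rfl⟩
  rw [inner_sub_left, sub_eq_zero]
  exact (inner_fderiv_tangentCoord h X w).symm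

lemma norm_fderiv_tangentCoord_le (h : Function.Injective (fderiv ℝ f u))
    (X : EuclideanSpace ℝ (Fin m)) : ‖fderiv ℝ f u (tangentCoord f u X)‖ ≤ ‖X‖ := by
  have h1 := inner_fderiv_tangentCoord h X (tangentCoord f u X)
  rw [real_inner_self_eq_norm_sq] at h1
  have h2 := real_inner_le_norm X (fderiv ℝ f u (tangentCoord f u X))
  rw [← h1] at h2
  by_contra! h3
  have : 0 < ‖fderiv ℝ f u (tangentCoord f u X)‖ := (norm_nonneg X).trans_lt h3
  nlinarith

/-- Jacobi's formula. In the Leibniz expansion, the terms in which column `i` is differentiated add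
up to the determinant with that column replaced by its derivative, which Cramer's rule expresses
through the adjugate. -/
lemma hasDerivAt_det {N : Type*} [Fintype N] [DecidableEq N] {A : ℝ → Matrix N N ℝ}
    {A' : Matrix N N ℝ} {t : ℝ} (hA : ∀ i j, HasDerivAt (fun s => A s i j) (A' i j) t) :
    HasDerivAt (fun s => (A s).det) ((A t).adjugate * A').trace t := by
  have h1 : HasDerivAt (fun s => (A s).det)
      (∑ σ : Equiv.Perm N, Equiv.Perm.sign σ •
        ∑ i, (∏ j ∈ Finset.univ.erase i, A t (σ j) j) • A' (σ i) i) t := by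
    simp_rw [Matrix.det_apply]
    refine HasDerivAt.fun_sum fun σ _ => ?_
    exact (HasDerivAt.fun_finsetProd fun i _ => hA (σ i) i).const_smul (Equiv.Perm.sign σ)
  convert h1 using 1
  have h2 : ∀ i, (∑ σ : Equiv.Perm N, Equiv.Perm.sign σ •
      ((∏ j ∈ Finset.univ.erase i, A t (σ j) j) • A' (σ i) i)) =
      ((A t).updateCol i (fun k => A' k i)).det := by
    intro i
    rw [Matrix.det_apply]
    refine Finset.sum_congr rfl fun σ _ => ?_
    rw [← Finset.mul_prod_erase Finset.univ _ (Finset.mem_univ i)]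
    congr 1
    rw [smul_eq_mul, mul_comm]
    congr 1
    · simp
    · refine Finset.prod_congr rfl fun j hj => ?_
      rw [Matrix.updateCol_ne (Finset.ne_of_mem_erase hj)]
  simp_rw [Finset.smul_sum]
  rw [Finset.sum_comm]
  simp_rw [h2, ← Matrix.cramer_apply, Matrix.cramer_eq_adjugate_mulVec]
  simp [Matrix.trace, Matrix.mul_apply, Matrix.mulVec, dotProduct]

end LocalCalculus

/-! ### Divergence of the tangential part of the position vector. -/

section Divergence

variable {n m : ℕ} {f : EuclideanSpace ℝ (Fin n) → EuclideanSpace ℝ (Fin m)}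
  {u : EuclideanSpace ℝ (Fin n)}

lemma contDiffAt_partialDeriv (hf : ContDiffAt ℝ ∞ f u) (i : Fin n) :
    ContDiffAt ℝ ∞ (partialDeriv f i) u :=
  (hf.fderiv_right (m := ∞) (by simp)).clm_apply contDiffAt_const

lemma contDiffAt_inducedMetric (hf : ContDiffAt ℝ ∞ f u) (i j : Fin n) :
    ContDiffAt ℝ ∞ (fun v => inducedMetric f v i j) u :=
  (contDiffAt_partialDeriv hf i).inner ℝ (contDiffAt_partialDeriv hf j)

lemma contDiffAt_matrix_det {V : Type*} [NormedAddCommGroup V] [NormedSpace ℝ V] {N : Type*}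
    [Fintype N] [DecidableEq N] {A : V → Matrix N N ℝ} {x : V}
    (hA : ∀ i j, ContDiffAt ℝ ∞ (fun v => A v i j) x) :
    ContDiffAt ℝ ∞ (fun v => (A v).det) x := by
  simp_rw [Matrix.det_apply]
  exact ContDiffAt.sum fun σ _ => (contDiffAt_prod fun i _ => hA _ _).const_smul _

lemma contDiffAt_matrix_inv {V : Type*} [NormedAddCommGroup V] [NormedSpace ℝ V] {N : Type*}
    [Fintype N] [DecidableEq N] {A : V → Matrix N N ℝ} {x : V}
    (hA : ∀ i j, ContDiffAt ℝ ∞ (fun v => A v i j) x) (h : (A x).det ≠ 0) (i j : N) :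
    ContDiffAt ℝ ∞ (fun v => (A v)⁻¹ i j) x := by
  simp_rw [Matrix.inv_def, Matrix.smul_apply, Ring.inverse_eq_inv', smul_eq_mul,
    Matrix.adjugate_apply]
  refine ((contDiffAt_matrix_det hA).inv h).mul (contDiffAt_matrix_det fun a b => ?_)
  simp_rw [Matrix.updateRow_apply]
  split_ifs
  · exact contDiffAt_const
  · exact hA a b

lemma contDiffAt_sqrt_det (hf : ContDiffAt ℝ ∞ f u) (h : Function.Injective (fderiv ℝ f u)) :
    ContDiffAt ℝ ∞ (fun v => √(inducedMetric f v).det) u :=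
  (contDiffAt_matrix_det (contDiffAt_inducedMetric hf)).sqrt (inducedMetric_det_pos h).ne'

lemma contDiffAt_tangentCoord (hf : ContDiffAt ℝ ∞ f u) (h : Function.Injective (fderiv ℝ f u))
    (x₀ : EuclideanSpace ℝ (Fin m)) (i : Fin n) :
    ContDiffAt ℝ ∞ (fun v => tangentCoord f v (f v - x₀) i) u := by
  simp only [tangentCoord, Matrix.mulVec, dotProduct]
  exact ContDiffAt.sum fun j _ => (contDiffAt_matrix_inv (contDiffAt_inducedMetric hf)
    (inducedMetric_det_pos h).ne' i j).mul
    ((hf.sub contDiffAt_const).inner ℝ (contDiffAt_partialDeriv hf j))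

lemma partialDeriv_comm (hf : ContDiffAt ℝ ∞ f u) (i j : Fin n) :
    partialDeriv (partialDeriv f j) i u = partialDeriv (partialDeriv f i) j u := by
  have hs : IsSymmSndFDerivAt ℝ f u := hf.isSymmSndFDerivAt
    (by rw [minSmoothness_of_isRCLikeNormedField]; exact WithTop.coe_le_coe.2 (le_top : (2 : ℕ∞) ≤ ⊤))
  have hd : DifferentiableAt ℝ (fderiv ℝ f) u :=
    (hf.fderiv_right (m := ∞) (by simp)).differentiableAt (by simp)
  have key : ∀ a b : Fin n, partialDeriv (partialDeriv f b) a u =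
      fderiv ℝ (fderiv ℝ f) u (EuclideanSpace.single a 1) (EuclideanSpace.single b 1) := by
    intro a b
    have : partialDeriv f b = fun v => fderiv ℝ f v (EuclideanSpace.single b 1) := rfl
    rw [partialDeriv, this, fderiv_clm_apply hd (differentiableAt_const _)]
    simp
  rw [key, key, hs.eq]

/-- First variation in a local parametrization: the divergence of the tangential part of the
position vector is `n + ⟪H, f - x₀⟫`. -/
lemma sum_fderiv_tangentCoord (hf : ContDiffAt ℝ ∞ f u) (h : Function.Injective (fderiv ℝ f u))
    (x₀ : EuclideanSpace ℝ (Fin m)) :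
    ∑ i, fderiv ℝ (fun v => √(inducedMetric f v).det * tangentCoord f v (f v - x₀) i) u
      (EuclideanSpace.single i 1) =
    √(inducedMetric f u).det * (n + inner ℝ (localMeanCurvature f u) (f u - x₀)) := by
  set e : Fin n → EuclideanSpace ℝ (Fin n) := fun i => EuclideanSpace.single i 1 with he
  set p : Fin n → EuclideanSpace ℝ (Fin m) := fun i => partialDeriv f i u with hp
  set a : Fin n → Fin n → EuclideanSpace ℝ (Fin m) :=
    fun i j => partialDeriv (partialDeriv f j) i u with ha
  set G := inducedMetric f u with hG
  set ξ := tangentCoord f u (f u - x₀) with hξ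
  have hasym : ∀ i j, a i j = a j i := fun i j => partialDeriv_comm hf i j
  have hdet : 0 < G.det := inducedMetric_det_pos h
  have hunit : IsUnit G.det := hdet.ne'.isUnit
  have hsym : ∀ i j, G⁻¹ i j = G⁻¹ j i := by
    intro i j
    have := (inducedMetric_isHermitian (f := f) (u := u)).inv
    have := this.apply j i
    simpa using this
  have dp : ∀ i j, HasLineDerivAt ℝ (partialDeriv f j) (a i j) u (e i) := fun i j =>
    ((contDiffAt_partialDeriv hf j).differentiableAt (by simp)).hasFDerivAt.hasLineDerivAt _
  have dX : ∀ i, HasLineDerivAt ℝ (fun v => f v - x₀) (p i) u (e i) := fun i =>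
    ((hf.differentiableAt (by simp)).hasFDerivAt.sub_const x₀).hasLineDerivAt _
  have at0 : ∀ i, u + (0 : ℝ) • e i = u := by simp
  have dG : ∀ i j k, HasDerivAt (fun t : ℝ => inducedMetric f (u + t • e i) j k)
      (inner ℝ (p j) (a i k) + inner ℝ (a i j) (p k)) 0 := by
    intro i j k
    have := HasDerivAt.inner ℝ (dp i j) (dp i k)
    simp only [at0] at this
    exact this
  have db : ∀ i j, HasDerivAt (fun t : ℝ => inner ℝ (f (u + t • e i) - x₀)
      (partialDeriv f j (u + t • e i))) (inner ℝ (f u - x₀) (a i j) + G i j) 0 := by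
    intro i j
    have := HasDerivAt.inner ℝ (dX i) (dp i j)
    simp only [at0] at this
    exact this
  have dξ : ∀ i k, HasDerivAt (fun t : ℝ => tangentCoord f (u + t • e i)
      (f (u + t • e i) - x₀) k)
      (fderiv ℝ (fun v => tangentCoord f v (f v - x₀) k) u (e i)) 0 := fun i k =>
    ((contDiffAt_tangentCoord hf h x₀ k).differentiableAt (by simp)).hasFDerivAt.hasLineDerivAt _
  set ξ' : Fin n → Fin n → ℝ :=
    fun i k => fderiv ℝ (fun v => tangentCoord f v (f v - x₀) k) u (e i) with hξ'
  -- The system `G ξ = b` is differentiated implicitly along `e i`, which avoids the derivative of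
  -- `G⁻¹`. It holds where `det G ≠ 0`, hence near `t = 0`.
  have hlin : ∀ i j, ∑ k, G j k * ξ' i k = inner ℝ (f u - x₀) (a i j) + G i j -
      ∑ k, (inner ℝ (p j) (a i k) + inner ℝ (a i j) (p k)) * ξ k := by
    intro i j
    have h1 := HasDerivAt.fun_sum (u := Finset.univ) fun k _ => (dG i j k).mul (dξ i k)
    have hcont : ContinuousAt (fun t : ℝ => (inducedMetric f (u + t • e i)).det) 0 :=
      (hasDerivAt_det (A' := Matrix.of fun j k => inner ℝ (p j) (a i k) + inner ℝ (a i j) (p k))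
        (dG i)).continuousAt
    have hne : ∀ᶠ t : ℝ in 𝓝 0, (inducedMetric f (u + t • e i)).det ≠ 0 :=
      hcont.eventually_ne (by simpa only [at0] using hdet.ne')
    have h2 : (fun t : ℝ => ∑ k, inducedMetric f (u + t • e i) j k *
        tangentCoord f (u + t • e i) (f (u + t • e i) - x₀) k) =ᶠ[𝓝 0]
        fun t : ℝ => inner ℝ (f (u + t • e i) - x₀) (partialDeriv f j (u + t • e i)) := by
      filter_upwards [hne] with t ht
      have : (inducedMetric f (u + t • e i)).mulVec
          (tangentCoord f (u + t • e i) (f (u + t • e i) - x₀)).ofLp =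
          fun j => inner ℝ (f (u + t • e i) - x₀) (partialDeriv f j (u + t • e i)) := by
        rw [tangentCoord, Matrix.mulVec_mulVec, Matrix.mul_nonsing_inv _ ht.isUnit,
          Matrix.one_mulVec]
      exact congrFun this j
    have h3 := h1.unique ((db i j).congr_of_eventuallyEq h2)
    simp only [at0] at h3
    rw [← h3, Finset.sum_add_distrib]
    simp [hG, hξ, hξ']
  have hsol : ∀ i, ξ' i i = ∑ j, G⁻¹ i j * (inner ℝ (f u - x₀) (a i j) + G i j -
      ∑ k, (inner ℝ (p j) (a i k) + inner ℝ (a i j) (p k)) * ξ k) := by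
    intro i
    have h1 : G.mulVec (ξ' i) = fun j => inner ℝ (f u - x₀) (a i j) + G i j -
      ∑ k, (inner ℝ (p j) (a i k) + inner ℝ (a i j) (p k)) * ξ k := funext (hlin i)
    have h2 : ξ' i = G⁻¹.mulVec (G.mulVec (ξ' i)) := by
      rw [Matrix.mulVec_mulVec, Matrix.nonsing_inv_mul _ hunit, Matrix.one_mulVec]
    rw [h1] at h2
    exact congrFun h2 i
  -- Jacobi's formula with `adj G = det G • G⁻¹`. By symmetry of `G⁻¹` the two halves of the
  -- derivative of `G` contribute equally, and the resulting `2` cancels that of the square root.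
  have dw : ∀ i, HasDerivAt (fun t : ℝ => √(inducedMetric f (u + t • e i)).det)
      (√G.det * (∑ j, ∑ k, G⁻¹ j k * inner ℝ (p j) (a i k))) 0 := by
    intro i
    have h1 := (hasDerivAt_det
      (A' := Matrix.of fun j k => inner ℝ (p j) (a i k) + inner ℝ (a i j) (p k)) (dG i)).sqrt
      (by simpa only [at0] using hdet.ne')
    convert h1 using 1
    simp only [at0]
    have hadj : G.adjugate = G.det • G⁻¹ := by
      rw [Matrix.inv_def, smul_smul, Ring.inverse_eq_inv', mul_inv_cancel₀ hdet.ne', one_smul]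
    change _ = (G.adjugate * _).trace / (2 * √G.det)
    rw [hadj, Matrix.smul_mul, Matrix.trace_smul]
    have htr : (G⁻¹ * (Matrix.of fun j k => inner ℝ (p j) (a i k) + inner ℝ (a i j) (p k))).trace =
        2 * ∑ j, ∑ k, G⁻¹ j k * inner ℝ (p j) (a i k) := by
      simp only [Matrix.trace, Matrix.diag, Matrix.mul_apply, Matrix.of_apply, mul_add,
        Finset.sum_add_distrib, two_mul]
      congr 1
      · rw [Finset.sum_comm]
        exact Finset.sum_congr rfl fun j _ => Finset.sum_congr rfl fun k _ => by rw [hsym]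
      · exact Finset.sum_congr rfl fun j _ => Finset.sum_congr rfl fun k _ => by
          rw [real_inner_comm]
    rw [htr, smul_eq_mul, eq_div_iff (by positivity)]
    nth_rewrite 3 [← Real.mul_self_sqrt hdet.le]
    ring
  have hterm : ∀ i, fderiv ℝ (fun v => √(inducedMetric f v).det *
      tangentCoord f v (f v - x₀) i) u (e i) =
      √G.det * (∑ j, ∑ k, G⁻¹ j k * inner ℝ (p j) (a i k)) * ξ i + √G.det * ξ' i i := by
    intro i
    have h1 := ((contDiffAt_sqrt_det hf h).mul
      (contDiffAt_tangentCoord hf h x₀ i)).differentiableAt (by simp)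
    have h2 := h1.hasFDerivAt.hasLineDerivAt (e i)
    have h3 := (dw i).mul (dξ i i)
    have h4 := HasDerivAt.unique h2 h3
    simp only [at0] at h4
    exact h4
  rw [Finset.sum_congr rfl fun i _ => hterm i]
  simp_rw [hsol]
  have hN : ∀ v, inner ℝ ((LinearMap.range (fderiv ℝ f u).toLinearMap)ᗮ.starProjection v)
      (f u - x₀) = inner ℝ (f u - x₀) v - ∑ k, ξ k * inner ℝ (p k) v := by
    intro v
    rw [Submodule.inner_starProjection_left_eq_right, starProjection_range_orthogonal h,
      inner_sub_right, real_inner_comm]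
    congr 1
    rw [map_eq_sum_single, inner_sum]
    refine Finset.sum_congr rfl fun k _ => ?_
    rw [real_inner_smul_right, real_inner_comm]
    rfl
  have hH : inner ℝ (localMeanCurvature f u) (f u - x₀) =
      ∑ i, ∑ j, G⁻¹ i j * (inner ℝ (f u - x₀) (a i j) - ∑ k, ξ k * inner ℝ (p k) (a i j)) := by
    rw [localMeanCurvature, sum_inner]
    refine Finset.sum_congr rfl fun i _ => ?_
    rw [sum_inner]
    refine Finset.sum_congr rfl fun j _ => ?_
    rw [real_inner_smul_left, hN]
  -- The dimension enters as the trace of `G⁻¹ * G`.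
  have hn : (n : ℝ) = ∑ i, ∑ j, G⁻¹ i j * G i j := by
    have : (G⁻¹ * G).trace = n := by rw [Matrix.nonsing_inv_mul _ hunit]; simp
    rw [← this]
    simp only [Matrix.trace, Matrix.diag, Matrix.mul_apply]
    refine Finset.sum_congr rfl fun i _ => Finset.sum_congr rfl fun j _ => ?_
    congr 1
    exact real_inner_comm (F := EuclideanSpace ℝ (Fin m)) _ _
  rw [hH, hn, Finset.sum_add_distrib]
  -- After reindexing, by symmetry of `a` and `G⁻¹`, the derivative of the density cancels the terms
  -- `⟪p j, a i k⟫ ξ k` of `hsol`. The terms `⟪a i j, p k⟫ ξ k` that remain are the tangential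
  -- correction in `hH`.
  have e1 : ∑ i, √G.det * (∑ j, ∑ k, G⁻¹ j k * inner ℝ (p j) (a i k)) * ξ i =
      √G.det * ∑ i, ∑ j, ∑ k, G⁻¹ i j * (inner ℝ (p j) (a i k) * ξ k) := by
    rw [Finset.mul_sum]
    simp_rw [mul_assoc, ← Finset.mul_sum]
    congr 1
    simp_rw [Finset.sum_mul, Finset.mul_sum]
    rw [Finset.sum_comm]
    calc ∑ j, ∑ i, ∑ k, G⁻¹ j k * inner ℝ (p j) (a i k) * ξ i
        = ∑ j, ∑ k, ∑ i, G⁻¹ j k * inner ℝ (p j) (a i k) * ξ i :=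
          Finset.sum_congr rfl fun j _ => Finset.sum_comm
      _ = ∑ k, ∑ j, ∑ i, G⁻¹ j k * inner ℝ (p j) (a i k) * ξ i := Finset.sum_comm
      _ = _ := Finset.sum_congr rfl fun i _ => Finset.sum_congr rfl fun j _ =>
          Finset.sum_congr rfl fun k _ => by rw [hsym, hasym]; ring
  rw [e1, ← Finset.mul_sum, ← mul_add]
  congr 1
  simp_rw [← Finset.sum_add_distrib]
  refine Finset.sum_congr rfl fun i _ => Finset.sum_congr rfl fun j _ => ?_
  simp_rw [← Finset.mul_sum]
  rw [← mul_add, ← mul_add]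
  congr 1
  simp_rw [add_mul, Finset.sum_add_distrib]
  have : ∑ k, ξ k * inner ℝ (p k) (a i j) = ∑ k, inner ℝ (a i j) (p k) * ξ k :=
    Finset.sum_congr rfl fun k _ => by rw [real_inner_comm, mul_comm]
  rw [this]
  ring

end Divergence

/-! ### Chart independence of density, tangential field and mean curvature. -/

section ChangeOfChart

variable {n m : ℕ} {f f' : EuclideanSpace ℝ (Fin n) → EuclideanSpace ℝ (Fin m)}
  {ψ : EuclideanSpace ℝ (Fin n) → EuclideanSpace ℝ (Fin n)} {u : EuclideanSpace ℝ (Fin n)}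

/-- The Jacobian matrix of `ψ` at `u`. -/
def jacobianMatrix (ψ : EuclideanSpace ℝ (Fin n) → EuclideanSpace ℝ (Fin n))
    (u : EuclideanSpace ℝ (Fin n)) : Matrix (Fin n) (Fin n) ℝ :=
  LinearMap.toMatrix (EuclideanSpace.basisFun (Fin n) ℝ).toBasis
    (EuclideanSpace.basisFun (Fin n) ℝ).toBasis (fderiv ℝ ψ u).toLinearMap

lemma jacobianMatrix_apply (a i : Fin n) :
    jacobianMatrix ψ u a i = fderiv ℝ ψ u (EuclideanSpace.single i 1) a := by
  simp [jacobianMatrix, LinearMap.toMatrix_apply]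

lemma det_jacobianMatrix : (jacobianMatrix ψ u).det = (fderiv ℝ ψ u).det := by
  rw [jacobianMatrix, LinearMap.det_toMatrix]

lemma fderiv_eq_comp (hf : DifferentiableAt ℝ f (ψ u)) (hψ : DifferentiableAt ℝ ψ u)
    (he : f' =ᶠ[𝓝 u] f ∘ ψ) :
    fderiv ℝ f' u = (fderiv ℝ f (ψ u)).comp (fderiv ℝ ψ u) := by
  rw [he.fderiv_eq, fderiv_comp u hf hψ]

lemma inducedMetric_comp (hf : DifferentiableAt ℝ f (ψ u)) (hψ : DifferentiableAt ℝ ψ u)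
    (he : f' =ᶠ[𝓝 u] f ∘ ψ) :
    inducedMetric f' u =
      (jacobianMatrix ψ u).transpose * inducedMetric f (ψ u) * jacobianMatrix ψ u := by
  ext i j
  have h1 : inducedMetric f' u i j = inner ℝ (fderiv ℝ f (ψ u)
      (fderiv ℝ ψ u (EuclideanSpace.single i 1))) (fderiv ℝ f (ψ u)
      (fderiv ℝ ψ u (EuclideanSpace.single j 1))) := by
    simp only [inducedMetric, partialDeriv, Matrix.of_apply, fderiv_eq_comp hf hψ he,
      ContinuousLinearMap.comp_apply]
  rw [h1, inner_fderiv_eq, Matrix.mul_assoc, Matrix.mul_apply]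
  simp only [dotProduct, Matrix.transpose_apply, jacobianMatrix_apply, Matrix.mul_apply,
    Matrix.mulVec]

/-- Determinants of `G' = Jᵀ G J`; the factor `|det J|` is the one of the change of variables
formula, so areas agree on chart overlaps. -/
lemma det_inducedMetric_comp (hf : DifferentiableAt ℝ f (ψ u)) (hψ : DifferentiableAt ℝ ψ u)
    (he : f' =ᶠ[𝓝 u] f ∘ ψ) :
    √(inducedMetric f' u).det = |(fderiv ℝ ψ u).det| * √(inducedMetric f (ψ u)).det := by
  rw [inducedMetric_comp hf hψ he, Matrix.det_mul, Matrix.det_mul, Matrix.det_transpose,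
    det_jacobianMatrix, mul_right_comm, Real.sqrt_mul (mul_self_nonneg _), Real.sqrt_mul_self_eq_abs]

lemma fderiv_injective_of_comp (hf : DifferentiableAt ℝ f (ψ u)) (hψ : DifferentiableAt ℝ ψ u)
    (he : f' =ᶠ[𝓝 u] f ∘ ψ) (h' : Function.Injective (fderiv ℝ f' u)) :
    Function.Injective (fderiv ℝ ψ u) := by
  rw [fderiv_eq_comp hf hψ he] at h'
  exact Function.Injective.of_comp h'

lemma fderiv_surjective_of_comp (hf : DifferentiableAt ℝ f (ψ u)) (hψ : DifferentiableAt ℝ ψ u)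
    (he : f' =ᶠ[𝓝 u] f ∘ ψ) (h' : Function.Injective (fderiv ℝ f' u)) :
    Function.Surjective (fderiv ℝ ψ u) :=
  LinearMap.injective_iff_surjective (f := (fderiv ℝ ψ u).toLinearMap).1
    (fderiv_injective_of_comp hf hψ he h')

/-- Both sides solve the same normal equations, because `dψ` is surjective and every test vector
comes from the first chart. -/
lemma fderiv_tangentCoord_comp (hf : DifferentiableAt ℝ f (ψ u)) (hψ : DifferentiableAt ℝ ψ u)
    (he : f' =ᶠ[𝓝 u] f ∘ ψ) (h : Function.Injective (fderiv ℝ f (ψ u)))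
    (h' : Function.Injective (fderiv ℝ f' u)) (X : EuclideanSpace ℝ (Fin m)) :
    fderiv ℝ ψ u (tangentCoord f' u X) = tangentCoord f (ψ u) X := by
  refine eq_tangentCoord h fun w => ?_
  obtain ⟨v, rfl⟩ := fderiv_surjective_of_comp hf hψ he h' w
  have := inner_fderiv_tangentCoord h' X v
  rwa [fderiv_eq_comp hf hψ he] at this

lemma partialDeriv_partialDeriv_eq (hf : ContDiffAt ℝ ∞ f u) (i j : Fin n) :
    partialDeriv (partialDeriv f j) i u =
      fderiv ℝ (fderiv ℝ f) u (EuclideanSpace.single i 1) (EuclideanSpace.single j 1) := by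
  have hd : DifferentiableAt ℝ (fderiv ℝ f) u :=
    (hf.fderiv_right (m := ∞) (by simp)).differentiableAt (by simp)
  have : partialDeriv f j = fun v => fderiv ℝ f v (EuclideanSpace.single j 1) := rfl
  rw [partialDeriv, this, fderiv_clm_apply hd (differentiableAt_const _)]
  simp

/-- The second derivative of `ψ` enters only through a tangent vector `df w`; since the normal
projection kills it, the value of `w` is irrelevant. -/
lemma partialDeriv_partialDeriv_comp (hf : ContDiffAt ℝ ∞ f (ψ u)) (hψ : ContDiffAt ℝ ∞ ψ u)
    (he : f' =ᶠ[𝓝 u] f ∘ ψ) (i j : Fin n) :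
    ∃ w, partialDeriv (partialDeriv f' j) i u =
      fderiv ℝ (fderiv ℝ f) (ψ u) (fderiv ℝ ψ u (EuclideanSpace.single i 1))
        (fderiv ℝ ψ u (EuclideanSpace.single j 1)) + fderiv ℝ f (ψ u) w := by
  have hψd := hψ.differentiableAt (by simp)
  have hd : DifferentiableAt ℝ (fderiv ℝ f) (ψ u) :=
    (hf.fderiv_right (m := ∞) (by simp)).differentiableAt (by simp)
  have hdψ : DifferentiableAt ℝ (fderiv ℝ ψ) u :=
    (hψ.fderiv_right (m := ∞) (by simp)).differentiableAt (by simp)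
  have h1 : partialDeriv f' j =ᶠ[𝓝 u] fun v =>
      fderiv ℝ f (ψ v) (fderiv ℝ ψ v (EuclideanSpace.single j 1)) := by
    have hfe : ∀ᶠ v in 𝓝 u, ContDiffAt ℝ 1 f (ψ v) :=
      hψ.continuousAt.eventually ((hf.of_le (m := 1) (by simp)).eventually (by simp))
    have hψe : ∀ᶠ v in 𝓝 u, ContDiffAt ℝ 1 ψ v :=
      (hψ.of_le (m := 1) (by simp)).eventually (by simp)
    filter_upwards [hfe, hψe, he.eventuallyEq_nhds] with v h1 h2 h3
    rw [partialDeriv, fderiv_eq_comp (h1.differentiableAt (by simp))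
      (h2.differentiableAt (by simp)) h3]
    rfl
  refine ⟨fderiv ℝ (fderiv ℝ ψ) u (EuclideanSpace.single i 1) (EuclideanSpace.single j 1), ?_⟩
  have h2 : fderiv ℝ (fun v => fderiv ℝ f (ψ v)) u = (fderiv ℝ (fderiv ℝ f) (ψ u)).comp
      (fderiv ℝ ψ u) := fderiv_comp u hd hψd
  have h3 : DifferentiableAt ℝ (fun v => fderiv ℝ f (ψ v)) u := hd.comp u hψd
  rw [partialDeriv, h1.fderiv_eq, fderiv_clm_apply h3
    (hdψ.clm_apply (differentiableAt_const _)), h2, fderiv_clm_apply hdψ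
    (differentiableAt_const _)]
  simp [add_comm]

lemma jacobianMatrix_mul_inv (hf : DifferentiableAt ℝ f (ψ u)) (hψ : DifferentiableAt ℝ ψ u)
    (he : f' =ᶠ[𝓝 u] f ∘ ψ) (h' : Function.Injective (fderiv ℝ f' u)) :
    jacobianMatrix ψ u * (inducedMetric f' u)⁻¹ * (jacobianMatrix ψ u).transpose =
      (inducedMetric f (ψ u))⁻¹ := by
  have hdet : (inducedMetric f' u).det ≠ 0 := (inducedMetric_det_pos h').ne'
  rw [inducedMetric_comp hf hψ he, Matrix.det_mul] at hdet
  have hu : IsUnit (jacobianMatrix ψ u).det := (right_ne_zero_of_mul hdet).isUnit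
  have hut : IsUnit (jacobianMatrix ψ u).transpose.det := by rwa [Matrix.det_transpose]
  rw [inducedMetric_comp hf hψ he, Matrix.mul_inv_rev, Matrix.mul_inv_rev,
    Matrix.mul_nonsing_inv_cancel_left _ _ hu, Matrix.mul_assoc, Matrix.nonsing_inv_mul _ hut,
    Matrix.mul_one]

/-- The normal space is unchanged, the normal part of the Hessian transforms as a bilinear form, and
its two Jacobians are absorbed by `J G'⁻¹ Jᵀ = G⁻¹`. -/
lemma localMeanCurvature_comp (hf : ContDiffAt ℝ ∞ f (ψ u)) (hψ : ContDiffAt ℝ ∞ ψ u)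
    (he : f' =ᶠ[𝓝 u] f ∘ ψ) (h' : Function.Injective (fderiv ℝ f' u)) :
    localMeanCurvature f' u = localMeanCurvature f (ψ u) := by
  have hfd := hf.differentiableAt (by simp)
  have hψd := hψ.differentiableAt (by simp)
  have hsurj := fderiv_surjective_of_comp hfd hψd he h'
  have hrange : LinearMap.range (fderiv ℝ f' u).toLinearMap =
      LinearMap.range (fderiv ℝ f (ψ u)).toLinearMap := by
    rw [fderiv_eq_comp hfd hψd he, ContinuousLinearMap.toLinearMap_comp]
    exact LinearMap.range_comp_of_range_eq_top _ (LinearMap.range_eq_top.2 hsurj)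
  set N := (LinearMap.range (fderiv ℝ f (ψ u)).toLinearMap)ᗮ.starProjection with hN
  have hN0 : ∀ w, N (fderiv ℝ f (ψ u) w) = 0 := fun w => by
    rw [hN, Submodule.starProjection_apply_eq_zero_iff]
    exact Submodule.le_orthogonal_orthogonal _ ⟨w, rfl⟩
  have hterm : ∀ i j, N (partialDeriv (partialDeriv f' j) i u) =
      ∑ a, ∑ b, (jacobianMatrix ψ u a i * jacobianMatrix ψ u b j) •
        N (partialDeriv (partialDeriv f b) a (ψ u)) := by
    intro i j
    obtain ⟨w, hw⟩ := partialDeriv_partialDeriv_comp hf hψ he i j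
    rw [hw, map_add, hN0, add_zero, map_eq_sum_single (fderiv ℝ (fderiv ℝ f) (ψ u)),
      sum_apply, map_sum]
    refine Finset.sum_congr rfl fun a _ => ?_
    rw [smul_apply, map_eq_sum_single (_ : _ →L[ℝ] EuclideanSpace ℝ (Fin m))
      (fderiv ℝ ψ u (EuclideanSpace.single j 1)), map_smul, map_sum, Finset.smul_sum]
    refine Finset.sum_congr rfl fun b _ => ?_
    rw [map_smul, smul_smul, partialDeriv_partialDeriv_eq hf, jacobianMatrix_apply,
      jacobianMatrix_apply]
  have hinv := jacobianMatrix_mul_inv hfd hψd he h'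
  have hN' : (LinearMap.range (fderiv ℝ f' u).toLinearMap)ᗮ.starProjection = N := by
    simp only [hN, hrange]
  simp only [localMeanCurvature]
  rw [hN', ← hN]
  simp_rw [hterm, ← hinv, Matrix.mul_apply, Matrix.transpose_apply, Finset.smul_sum, smul_smul,
    Finset.sum_mul, Finset.sum_smul]
  have swap : ∀ T : Fin n → Fin n → Fin n → Fin n → EuclideanSpace ℝ (Fin m),
      ∑ i, ∑ j, ∑ a, ∑ b, T i j a b = ∑ a, ∑ b, ∑ j, ∑ i, T i j a b := by
    intro T
    calc _ = ∑ i, ∑ a, ∑ j, ∑ b, T i j a b := Finset.sum_congr rfl fun i _ => Finset.sum_comm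
      _ = ∑ a, ∑ i, ∑ j, ∑ b, T i j a b := Finset.sum_comm
      _ = ∑ a, ∑ i, ∑ b, ∑ j, T i j a b := Finset.sum_congr rfl fun a _ =>
        Finset.sum_congr rfl fun i _ => Finset.sum_comm
      _ = ∑ a, ∑ b, ∑ i, ∑ j, T i j a b := Finset.sum_congr rfl fun a _ => Finset.sum_comm
      _ = _ := Finset.sum_congr rfl fun a _ => Finset.sum_congr rfl fun b _ => Finset.sum_comm
  rw [swap]
  refine Finset.sum_congr rfl fun a _ => Finset.sum_congr rfl fun b _ =>
    Finset.sum_congr rfl fun j _ => Finset.sum_congr rfl fun i _ => ?_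
  congr 1
  ring

/-- The integrand of the first variation formula for the position vector field, tested with
the function `ζ`, in a local parametrization. -/
def divIntegrand (f : EuclideanSpace ℝ (Fin n) → EuclideanSpace ℝ (Fin m))
    (x₀ : EuclideanSpace ℝ (Fin m)) (ζ : EuclideanSpace ℝ (Fin n) → ℝ)
    (u : EuclideanSpace ℝ (Fin n)) : ℝ :=
  (n + inner ℝ (localMeanCurvature f u) (f u - x₀)) * ζ u +
    fderiv ℝ ζ u (tangentCoord f u (f u - x₀))

lemma divIntegrand_comp {ζ ζ' : EuclideanSpace ℝ (Fin n) → ℝ} (hf : ContDiffAt ℝ ∞ f (ψ u))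
    (hψ : ContDiffAt ℝ ∞ ψ u) (he : f' =ᶠ[𝓝 u] f ∘ ψ)
    (h : Function.Injective (fderiv ℝ f (ψ u))) (h' : Function.Injective (fderiv ℝ f' u))
    (hζ : DifferentiableAt ℝ ζ (ψ u)) (hζ' : ζ' =ᶠ[𝓝 u] ζ ∘ ψ) (x₀ : EuclideanSpace ℝ (Fin m)) :
    divIntegrand f' x₀ ζ' u = divIntegrand f x₀ ζ (ψ u) := by
  have hψd := hψ.differentiableAt (by simp)
  rw [divIntegrand, divIntegrand, localMeanCurvature_comp hf hψ he h', hζ'.fderiv_eq,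
    fderiv_comp u hζ hψd, ContinuousLinearMap.comp_apply,
    fderiv_tangentCoord_comp (hf.differentiableAt (by simp)) hψd he h h', he.eq_of_nhds,
    hζ'.eq_of_nhds]
  rfl

end ChangeOfChart

/-! ### The area measure in charts and its gluing. -/

section AreaMeasure

variable {n m : ℕ} {M : Type*} [TopologicalSpace M] [ChartedSpace (EuclideanSpace ℝ (Fin n)) M]
  {F : M → EuclideanSpace ℝ (Fin m)}

lemma contDiffAt_localParam [IsManifold (𝓡 n) ∞ M] (hF : ContMDiff (𝓡 n) (𝓡 m) ∞ F) {x : M}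
    {u : EuclideanSpace ℝ (Fin n)} (hu : u ∈ (extChartAt (𝓡 n) x).target) :
    ContDiffAt ℝ ∞ (localParam n F x) u := by
  rw [← contMDiffAt_iff_contDiffAt]
  have h1 : ContMDiffAt 𝓘(ℝ, EuclideanSpace ℝ (Fin n)) (𝓡 n) ∞ (extChartAt (𝓡 n) x).symm u :=
    (contMDiffOn_extChartAt_symm x).contMDiffAt ((isOpen_extChartAt_target x).mem_nhds hu)
  exact (hF.contMDiffAt (x := (extChartAt (𝓡 n) x).symm u)).comp u h1

lemma contDiffAt_transition [IsManifold (𝓡 n) ∞ M] {x y : M} {u : EuclideanSpace ℝ (Fin n)}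
    (hu : u ∈ (extChartAt (𝓡 n) y).target)
    (hx : (extChartAt (𝓡 n) y).symm u ∈ (extChartAt (𝓡 n) x).source) :
    ContDiffAt ℝ ∞ (extChartAt (𝓡 n) x ∘ (extChartAt (𝓡 n) y).symm) u := by
  rw [← contMDiffAt_iff_contDiffAt]
  have h1 : ContMDiffAt 𝓘(ℝ, EuclideanSpace ℝ (Fin n)) (𝓡 n) ∞ (extChartAt (𝓡 n) y).symm u :=
    (contMDiffOn_extChartAt_symm y).contMDiffAt ((isOpen_extChartAt_target y).mem_nhds hu)
  exact (contMDiffAt_extChartAt' (by rwa [← extChartAt_source (𝓡 n)])).comp u h1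

lemma eventually_symm_mem_source {x y : M} {u : EuclideanSpace ℝ (Fin n)}
    (hu : u ∈ (extChartAt (𝓡 n) y).target)
    (hx : (extChartAt (𝓡 n) y).symm u ∈ (extChartAt (𝓡 n) x).source) :
    ∀ᶠ v in 𝓝 u, (extChartAt (𝓡 n) y).symm v ∈ (extChartAt (𝓡 n) x).source :=
  (continuousAt_extChartAt_symm'' hu).eventually
    ((isOpen_extChartAt_source x).mem_nhds hx)

/-- Supplies the hypothesis `f' =ᶠ f ∘ ψ` of the change of chart lemmas; the identity holds only
near `u`, where the inverse charts stay in the other source. -/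
lemma comp_symm_eventuallyEq {W : Type*} (η : M → W) {x y : M} {u : EuclideanSpace ℝ (Fin n)}
    (hu : u ∈ (extChartAt (𝓡 n) y).target)
    (hx : (extChartAt (𝓡 n) y).symm u ∈ (extChartAt (𝓡 n) x).source) :
    (fun v => η ((extChartAt (𝓡 n) y).symm v)) =ᶠ[𝓝 u]
      (fun v => η ((extChartAt (𝓡 n) x).symm v)) ∘
        (extChartAt (𝓡 n) x ∘ (extChartAt (𝓡 n) y).symm) := by
  filter_upwards [eventually_symm_mem_source hu hx] with v hv
  simp only [Function.comp_apply]
  rw [(extChartAt (𝓡 n) x).left_inv hv]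

/-- The density of the area measure in the chart at `x`. -/
def chartDensity (n : ℕ) {M : Type*} [TopologicalSpace M]
    [ChartedSpace (EuclideanSpace ℝ (Fin n)) M]
    (F : M → EuclideanSpace ℝ (Fin m)) (x : M) (u : EuclideanSpace ℝ (Fin n)) : ℝ :=
  √(inducedMetric (localParam n F x) u).det

/-- No regularity of `F` is needed, because the derivative of an arbitrary map is measurable. Hence
measurability holds on the whole space, off the chart target too. -/
lemma measurable_chartDensity (x : M) : Measurable (chartDensity n F x) := by
  refine Real.continuous_sqrt.measurable.comp (?_ : Measurable fun u =>
    (inducedMetric (localParam n F x) u).det)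
  simp_rw [Matrix.det_apply]
  refine Finset.measurable_sum _ fun σ _ => Measurable.const_smul ?_ _
  refine Finset.measurable_prod _ fun i _ => ?_
  have h : ∀ j, Measurable (partialDeriv (localParam n F x) j) := fun j =>
    measurable_fderiv_apply_const ℝ _ _
  exact (h _).inner (h _)

variable [MeasurableSpace M] [BorelSpace M]

/-- `Measure.map` is zero on maps that are not a.e. measurable, so this is what gives `chartArea`
its meaning. Continuity on the target suffices, as the measure is concentrated there. -/
lemma aemeasurable_extChartAt_symm (x : M) : AEMeasurable (extChartAt (𝓡 n) x).symm
    (((volume : Measure (EuclideanSpace ℝ (Fin n))).restrict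
      (extChartAt (𝓡 n) x).target).withDensity fun u => ENNReal.ofReal (chartDensity n F x u)) :=
  ((continuousOn_extChartAt_symm x).aemeasurable
    (isOpen_extChartAt_target x).measurableSet).mono_ac (withDensity_absolutelyContinuous _ _)

lemma chartArea_apply (x : M) {A : Set M} (hA : MeasurableSet A) :
    chartArea n F x A = ∫⁻ u in (extChartAt (𝓡 n) x).symm ⁻¹' A ∩ (extChartAt (𝓡 n) x).target,
      ENNReal.ofReal (chartDensity n F x u) := by
  have h := Measure.map_apply_of_aemeasurable (aemeasurable_extChartAt_symm (n := n) (F := F) x) hA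
  rw [withDensity_apply', Measure.restrict_restrict' (isOpen_extChartAt_target x).measurableSet] at h
  exact h

lemma chartArea_compl_source (x : M) :
    chartArea n F x (extChartAt (𝓡 n) x).sourceᶜ = 0 := by
  rw [chartArea_apply x (isOpen_extChartAt_source x).measurableSet.compl]
  have : (extChartAt (𝓡 n) x).symm ⁻¹' (extChartAt (𝓡 n) x).sourceᶜ ∩
      (extChartAt (𝓡 n) x).target = ∅ := by
    ext u
    simp only [mem_inter_iff, mem_preimage, mem_compl_iff, mem_empty_iff_false, iff_false, not_and]
    exact fun h1 h2 => h1 ((extChartAt (𝓡 n) x).map_target h2)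
  rw [this, setLIntegral_empty]

lemma chartArea_inter_source (x : M) (A : Set M) :
    chartArea n F x (A ∩ (extChartAt (𝓡 n) x).source) = chartArea n F x A :=
  measure_inter_conull (chartArea_compl_source x)

/-- Change of variables under the transition map, with `det_inducedMetric_comp` for the density. -/
lemma chartArea_eq_of_subset [IsManifold (𝓡 n) ∞ M] (hF : ContMDiff (𝓡 n) (𝓡 m) ∞ F)
    {x y : M} {A : Set M}
    (hA : MeasurableSet A) (hx : A ⊆ (extChartAt (𝓡 n) x).source)
    (hy : A ⊆ (extChartAt (𝓡 n) y).source) : chartArea n F x A = chartArea n F y A := by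
  set ψ := extChartAt (𝓡 n) x ∘ (extChartAt (𝓡 n) y).symm with hψ
  set S := (extChartAt (𝓡 n) y).symm ⁻¹' A ∩ (extChartAt (𝓡 n) y).target with hS
  have hSm : MeasurableSet S := by
    have h := MeasurableSet.subtype_image (isOpen_extChartAt_target (I := 𝓡 n) y).measurableSet
      ((continuousOn_extChartAt_symm (I := 𝓡 n) y).domRestrict.measurable hA)
    convert h using 1
    ext v
    simp [hS, and_comm]
  have hSd : ∀ u ∈ S, DifferentiableAt ℝ ψ u := fun u hu =>
    (contDiffAt_transition hu.2 (hx hu.1)).differentiableAt (by simp)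
  have himg : (extChartAt (𝓡 n) x).symm ⁻¹' A ∩ (extChartAt (𝓡 n) x).target = ψ '' S := by
    ext v
    constructor
    · rintro ⟨h1, h2⟩
      refine ⟨extChartAt (𝓡 n) y ((extChartAt (𝓡 n) x).symm v), ⟨?_, ?_⟩, ?_⟩
      · rw [mem_preimage, (extChartAt (𝓡 n) y).left_inv (hy h1)]; exact h1
      · exact (extChartAt (𝓡 n) y).map_source (hy h1)
      · simp only [hψ, Function.comp_apply]
        rw [(extChartAt (𝓡 n) y).left_inv (hy h1), (extChartAt (𝓡 n) x).right_inv h2]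
    · rintro ⟨u, hu, rfl⟩
      refine ⟨?_, (extChartAt (𝓡 n) x).map_source (hx hu.1)⟩
      simp only [hψ, Function.comp_apply, mem_preimage]
      rw [(extChartAt (𝓡 n) x).left_inv (hx hu.1)]; exact hu.1
  have hinjOn : InjOn ψ S := by
    intro u hu v hv huv
    have h1 := (extChartAt (𝓡 n) x).injOn (hx hu.1) (hx hv.1) huv
    rw [← (extChartAt (𝓡 n) y).right_inv hu.2, ← (extChartAt (𝓡 n) y).right_inv hv.2, h1]
  rw [chartArea_apply x hA, chartArea_apply y hA, himg,
    lintegral_image_eq_lintegral_abs_det_fderiv_mul _ hSm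
      (fun u hu => (hSd u hu).hasFDerivAt.hasFDerivWithinAt) hinjOn]
  refine setLIntegral_congr_fun hSm fun u hu => ?_
  have hd : DifferentiableAt ℝ (localParam n F x) (ψ u) :=
    (contDiffAt_localParam hF ((extChartAt (𝓡 n) x).map_source (hx hu.1))).differentiableAt
      (by simp)
  simp only [chartDensity]
  rw [det_inducedMetric_comp (f' := localParam n F y) hd (hSd u hu)
    (comp_symm_eventuallyEq F hu.2 (hx hu.1)),
    ENNReal.ofReal_mul (abs_nonneg _)]

/-- Replaces the supremum `area` by a measure that is computable in charts: countably many chart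
areas, each restricted to a piece of a disjoint partition. The inequality suffices, since the
entropy bounds `area` from above while all lower bounds are proved for `ν`. -/
lemma exists_measure_le_area [IsManifold (𝓡 n) ∞ M] [SecondCountableTopology M] [Nonempty M]
    (hF : ContMDiff (𝓡 n) (𝓡 m) ∞ F) :
    ∃ ν : Measure M, ν ≤ area n F ∧
      ∀ x, ν.restrict (extChartAt (𝓡 n) x).source = chartArea n F x := by
  obtain ⟨s, hsc, hs⟩ := TopologicalSpace.countable_cover_nhds
    (f := fun x : M => (extChartAt (𝓡 n) x).source) fun x => extChartAt_source_mem_nhds x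
  have hne : s.Nonempty := by
    by_contra! h
    simp [h] at hs
    exact not_isEmpty_of_nonempty M (univ_eq_empty_iff.1 hs.symm)
  obtain ⟨c, rfl⟩ := hsc.exists_eq_range hne
  rw [biUnion_range] at hs
  set D := disjointed fun j => (extChartAt (𝓡 n) (c j)).source with hD
  have hDm : ∀ j, MeasurableSet (D j) := fun j =>
    MeasurableSet.disjointed (fun j => (isOpen_extChartAt_source (c j)).measurableSet) j
  have hDU : ⋃ j, D j = univ := by rw [hD, iUnion_disjointed, hs]
  have hDd : Pairwise (Function.onFun Disjoint D) := disjoint_disjointed _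
  have hDs : ∀ j, D j ⊆ (extChartAt (𝓡 n) (c j)).source := fun j => disjointed_subset _ j
  have hsplit : ∀ (μ : Measure M) {A : Set M}, MeasurableSet A → μ A = ∑' j, μ (A ∩ D j) := by
    intro μ A hA
    rw [← measure_iUnion (fun i j hij => (hDd hij).mono inter_subset_right inter_subset_right)
      fun j => hA.inter (hDm j), ← inter_iUnion, hDU, inter_univ]
  refine ⟨Measure.sum fun j => (chartArea n F (c j)).restrict (D j), ?_, ?_⟩
  · refine Measure.le_iff.2 fun A hA => ?_
    rw [Measure.sum_apply _ hA, hsplit (area n F) hA]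
    refine ENNReal.tsum_le_tsum fun j => ?_
    rw [Measure.restrict_apply hA]
    exact le_iSup (fun x => chartArea n F x) (c j) _
  · intro x
    ext A hA
    have hxm := (isOpen_extChartAt_source (I := 𝓡 n) x).measurableSet
    rw [Measure.restrict_apply hA, Measure.sum_apply _ (hA.inter hxm),
      ← chartArea_inter_source x A, hsplit (chartArea n F x) (hA.inter hxm)]
    refine tsum_congr fun j => ?_
    rw [Measure.restrict_apply (hA.inter hxm)]
    exact chartArea_eq_of_subset hF ((hA.inter hxm).inter (hDm j))
      (inter_subset_right.trans (hDs j)) (inter_subset_left.trans inter_subset_right)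

end AreaMeasure

/-! ### The differential of an isometric immersion. -/

section RiemannianDistance

variable {n m : ℕ} {M : Type*} [TopologicalSpace M] [ChartedSpace (EuclideanSpace ℝ (Fin n)) M]
  [RiemannianBundle (fun x : M => TangentSpace (𝓡 n) x)]
  {F : M → EuclideanSpace ℝ (Fin m)}

lemma IsIsometricImmersion.norm_mfderiv (hF : IsIsometricImmersion n F) (x : M)
    (v : TangentSpace (𝓡 n) x) :
    ‖mfderiv (𝓡 n) (𝓡 m) F x v‖ = ‖v‖ := by
  have h := hF.2 x v v
  rw [norm_eq_sqrt_real_inner, norm_eq_sqrt_real_inner]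
  exact congrArg Real.sqrt h

lemma IsIsometricImmersion.injective_mfderiv (hF : IsIsometricImmersion n F) (x : M) :
    Function.Injective (mfderiv (𝓡 n) (𝓡 m) F x) := by
  refine (injective_iff_map_eq_zero _).2 fun v hv => ?_
  have h := hF.norm_mfderiv x v
  rw [hv] at h
  have h0 : ‖v‖ = 0 := h.symm.trans norm_zero
  exact norm_eq_zero.1 h0

/-- The chart composed with its inverse is locally the identity, so the inverse chart has injective
differential; `dF` is injective because it preserves norms. -/
lemma IsIsometricImmersion.injective_fderiv_localParam [IsManifold (𝓡 n) ∞ M]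
    (hF : IsIsometricImmersion n F) (x : M) (u : EuclideanSpace ℝ (Fin n))
    (hu : u ∈ (extChartAt (𝓡 n) x).target) :
    Function.Injective (fderiv ℝ (localParam n F x) u) := by
  have h1 : MDifferentiableAt (𝓡 n) (𝓡 m) F ((extChartAt (𝓡 n) x).symm u) :=
    hF.1.contMDiffAt.mdifferentiableAt (by simp)
  have h2 : MDifferentiableAt 𝓘(ℝ, EuclideanSpace ℝ (Fin n)) (𝓡 n) (extChartAt (𝓡 n) x).symm u :=
    ((contMDiffOn_extChartAt_symm (n := ∞) x).contMDiffAt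
      ((isOpen_extChartAt_target x).mem_nhds hu)).mdifferentiableAt (by simp)
  have h3 : MDifferentiableAt (𝓡 n) 𝓘(ℝ, EuclideanSpace ℝ (Fin n)) (extChartAt (𝓡 n) x)
      ((extChartAt (𝓡 n) x).symm u) :=
    mdifferentiableAt_extChartAt (by
      rw [← extChartAt_source (𝓡 n)]; exact (extChartAt (𝓡 n) x).map_target hu)
  have hinj : Function.Injective (mfderiv 𝓘(ℝ, EuclideanSpace ℝ (Fin n)) (𝓡 n)
      (extChartAt (𝓡 n) x).symm u) := by
    have h4 := mfderiv_comp u h3 h2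
    have h5 : (extChartAt (𝓡 n) x) ∘ (extChartAt (𝓡 n) x).symm =ᶠ[𝓝 u] id := by
      filter_upwards [(isOpen_extChartAt_target x).mem_nhds hu] with v hv
      exact (extChartAt (𝓡 n) x).right_inv hv
    rw [h5.mfderiv_eq, mfderiv_id] at h4
    have h6 : Function.Injective ((mfderiv (𝓡 n) 𝓘(ℝ, EuclideanSpace ℝ (Fin n))
      (extChartAt (𝓡 n) x) ((extChartAt (𝓡 n) x).symm u)) ∘
        (mfderiv 𝓘(ℝ, EuclideanSpace ℝ (Fin n)) (𝓡 n) (extChartAt (𝓡 n) x).symm u)) := by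
      have h7 := congrArg (fun L => (L : _ → _)) (congrArg DFunLike.coe h4)
      intro a b hab
      exact (congrFun h7 a).trans (hab.trans (congrFun h7 b).symm)
    exact Function.Injective.of_comp h6
  rw [← mfderiv_eq_fderiv]
  have h8 := mfderiv_comp u h1 h2
  change Function.Injective (mfderiv 𝓘(ℝ, EuclideanSpace ℝ (Fin n)) (𝓡 m)
    (F ∘ (extChartAt (𝓡 n) x).symm) u)
  rw [h8]
  exact (hF.injective_mfderiv _).comp hinj

end RiemannianDistance

/-! ### Lengths of curves and intrinsic distance. -/

section Lipschitz

open Manifold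

variable {n m : ℕ} {M : Type*} [PseudoEMetricSpace M] [ChartedSpace (EuclideanSpace ℝ (Fin n)) M]
  [RiemannianBundle (fun x : M => TangentSpace (𝓡 n) x)]
  {F : M → EuclideanSpace ℝ (Fin m)}

lemma pathELength_comp_isometricImmersion (hF : IsIsometricImmersion n F) {γ : ℝ → M} {a b : ℝ}
    (hγ : ContMDiffOn 𝓘(ℝ, ℝ) (𝓡 n) 1 γ (Icc a b)) :
    pathELength (𝓡 m) (F ∘ γ) a b = pathELength (𝓡 n) γ a b := by
  rw [pathELength_eq_lintegral_mfderiv_Ioo, pathELength_eq_lintegral_mfderiv_Ioo]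
  refine setLIntegral_congr_fun measurableSet_Ioo fun t ht => ?_
  have h1 : MDifferentiableAt 𝓘(ℝ, ℝ) (𝓡 n) γ t :=
    (hγ.contMDiffAt (Icc_mem_nhds ht.1 ht.2)).mdifferentiableAt (by simp)
  have h2 : MDifferentiableAt (𝓡 n) (𝓡 m) F (γ t) := hF.1.contMDiffAt.mdifferentiableAt (by simp)
  rw [mfderiv_comp t h2 h1, ← ofReal_norm, ← ofReal_norm]
  exact congrArg ENNReal.ofReal (hF.norm_mfderiv (γ t) _)

variable [IsRiemannianManifold (𝓡 n) M]

/-- `F` preserves lengths of curves, and both distances are infima of lengths. -/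
lemma IsIsometricImmersion.lipschitzWith (hF : IsIsometricImmersion n F) : LipschitzWith 1 F := by
  intro p q
  rw [ENNReal.coe_one, one_mul, IsRiemannianManifold.out (I := 𝓡 n) p q,
    IsRiemannianManifold.out (I := 𝓡 m) (F p) (F q)]
  refine le_of_forall_gt fun r hr => ?_
  obtain ⟨γ, h0, h1, hγ, hlen⟩ := exists_lt_of_riemannianEDist_lt hr
  refine (riemannianEDist_le_pathELength (γ := F ∘ γ) ?_ (by simp [h0]) (by simp [h1])
    zero_le_one).trans_lt ((pathELength_comp_isometricImmersion hF hγ).trans_lt hlen)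
  exact (hF.1.of_le (by simp)).comp_contMDiffOn hγ

/-- The distance between two points of a chart whose segment lies in the chart is controlled by
the derivative of the immersion along the segment. -/
lemma edist_extChartAt_symm_le [IsManifold (𝓡 n) ∞ M] (hF : IsIsometricImmersion n F) {x : M}
    {u v : EuclideanSpace ℝ (Fin n)} {c : ℝ}
    (hc : ∀ t ∈ Icc (0 : ℝ) 1, AffineMap.lineMap u v t ∈ (extChartAt (𝓡 n) x).target ∧
      ‖fderiv ℝ (localParam n F x) (AffineMap.lineMap u v t) (v - u)‖ ≤ c) :
    edist ((extChartAt (𝓡 n) x).symm u) ((extChartAt (𝓡 n) x).symm v) ≤ ENNReal.ofReal c := by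
  set γ : ℝ → M := (extChartAt (𝓡 n) x).symm ∘ (AffineMap.lineMap u v : ℝ → _) with hγdef
  have hline : ContDiff ℝ 1 (AffineMap.lineMap u v : ℝ → EuclideanSpace ℝ (Fin n)) := by
    exact (ContinuousAffineMap.lineMap (R := ℝ) u v).contDiff
  have hγ : ContMDiffOn 𝓘(ℝ, ℝ) (𝓡 n) 1 γ (Icc 0 1) :=
    (contMDiffOn_extChartAt_symm x).comp hline.contMDiff.contMDiffOn fun t ht => (hc t ht).1
  rw [IsRiemannianManifold.out (I := 𝓡 n)]
  refine (riemannianEDist_le_pathELength hγ (by simp [hγdef]) (by simp [hγdef])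
    zero_le_one).trans ?_
  rw [← pathELength_comp_isometricImmersion hF hγ, pathELength_eq_lintegral_mfderiv_Ioo]
  have hb : ∀ t ∈ Ioo (0 : ℝ) 1, ‖mfderiv 𝓘(ℝ, ℝ) (𝓡 m) (F ∘ γ) t 1‖ₑ ≤ ENNReal.ofReal c := by
    intro t ht
    rw [enorm_tangentSpace_vectorSpace]
    have ht' := hc t (Ioo_subset_Icc_self ht)
    have h1 : HasDerivAt (F ∘ γ) (fderiv ℝ (localParam n F x) (AffineMap.lineMap u v t) (v - u)) t :=
      ((contDiffAt_localParam hF.1 ht'.1).differentiableAt (by simp)).hasFDerivAt.comp_hasDerivAt t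
        AffineMap.hasDerivAt_lineMap
    rw [mfderiv_eq_fderiv]
    have h2 : fderiv ℝ (F ∘ γ) t 1 = _ := h1.deriv
    have h3 := ENNReal.ofReal_le_ofReal ht'.2
    rw [ofReal_norm] at h3
    exact (congrArg (fun z : EuclideanSpace ℝ (Fin m) => ‖z‖ₑ) h2).trans_le h3
  refine (setLIntegral_mono' measurableSet_Ioo hb).trans ?_
  simp

/-- The length space property, and the only input to Hopf–Rinow from Riemannian geometry besides
local compactness: cut a nearly minimizing curve at a suitable point. -/
lemma exists_edist_lt_of_edist_lt_add (n : ℕ) {M : Type*} [PseudoEMetricSpace M]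
    [ChartedSpace (EuclideanSpace ℝ (Fin n)) M]
    [RiemannianBundle (fun x : M => TangentSpace (𝓡 n) x)] [IsRiemannianManifold (𝓡 n) M] {p q : M}
    {r₁ r₂ : ℝ≥0∞} (h : edist p q < r₁ + r₂)
    (h1 : 0 < r₁) (h2 : 0 < r₂) : ∃ z : M, edist p z < r₁ ∧ edist z q < r₂ := by
  rcases lt_or_ge (edist p q) r₁ with hlt | hge
  · exact ⟨q, hlt, by simpa⟩
  rw [IsRiemannianManifold.out (I := 𝓡 n)] at h
  obtain ⟨γ, h0, h1', hγ, hlen⟩ := exists_lt_of_riemannianEDist_lt h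
  set ℓ := pathELength (𝓡 n) γ 0 1 with hℓ
  have hℓ1 : ℓ - r₂ < r₁ := by
    rcases le_or_gt ℓ r₂ with h | h
    · rwa [tsub_eq_zero_of_le h]
    · exact ENNReal.sub_lt_of_lt_add h.le hlen
  -- The cut is where the distance from `p` equals `c`: `c < r₁` bounds the first piece, and `ℓ - r₂
  -- < c` leaves less than `r₂` for the second.
  obtain ⟨c, hc1, hc2⟩ := exists_between hℓ1
  have hcont : ContinuousOn (fun t => edist p (γ t)) (Icc 0 1) :=
    (Continuous.edist continuous_const continuous_id).comp_continuousOn hγ.continuousOn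
  have hmem : c ∈ Icc (edist p (γ 0)) (edist p (γ 1)) := by
    rw [h0, h1', edist_self]
    exact ⟨zero_le, hc2.le.trans hge⟩
  obtain ⟨t, ht, htc⟩ := intermediate_value_Icc zero_le_one hcont hmem
  refine ⟨γ t, by simpa [htc] using hc2, ?_⟩
  have ha : edist p (γ t) ≤ pathELength (𝓡 n) γ 0 t := by
    rw [IsRiemannianManifold.out (I := 𝓡 n)]
    exact riemannianEDist_le_pathELength (hγ.mono (Icc_subset_Icc_right ht.2)) h0 rfl ht.1
  have hb : edist (γ t) q ≤ pathELength (𝓡 n) γ t 1 := by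
    rw [IsRiemannianManifold.out (I := 𝓡 n)]
    exact riemannianEDist_le_pathELength (hγ.mono (Icc_subset_Icc_left ht.1)) rfl h1' ht.2
  have hadd : pathELength (𝓡 n) γ 0 t + pathELength (𝓡 n) γ t 1 = ℓ := pathELength_add ht.1 ht.2
  have hcl : c + edist (γ t) q ≤ ℓ := by
    rw [← hadd]
    exact add_le_add (htc ▸ ha) hb
  have hctop : c ≠ ⊤ := (hc2.trans_le le_top).ne
  by_contra! hge2
  have : c + r₂ ≤ ℓ := (add_le_add le_rfl hge2).trans hcl
  have h3 : c ≤ ℓ - r₂ := by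
    have hr2 : r₂ ≠ ⊤ := by
      rintro rfl
      exact absurd (top_le_iff.1 (by simpa using this)) (hlen.trans_le le_top).ne
    exact ENNReal.le_sub_of_add_le_right hr2 this
  exact absurd hc1 (not_lt.2 h3)

end Lipschitz

/-! ### Hopf–Rinow for length spaces. -/

section HopfRinow

variable {X : Type*} [EMetricSpace X]

lemma isCompact_closedEBall_mono {p : X} {r s : NNReal} (h : r ≤ s)
    (hs : IsCompact (Metric.closedEBall p (s : ℝ≥0∞))) :
    IsCompact (Metric.closedEBall p (r : ℝ≥0∞)) :=
  hs.of_isClosed_subset Metric.isClosed_closedEBall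
    (Metric.closedEBall_subset_closedEBall (by exact_mod_cast h))

/-- The closed half of the continuity argument: with `δ < ε / 2`, the ball of radius `R` lies within
`ε / 2` of the compact ball of radius `R - δ`, so an `ε / 2`-net of the latter is an `ε`-net of the
former. -/
lemma isCompact_closedEBall_of_lt [CompleteSpace X]
    (hlen : ∀ (p q : X) (r₁ r₂ : ℝ≥0∞), 0 < r₁ → 0 < r₂ → edist p q < r₁ + r₂ →
      ∃ z, edist p z < r₁ ∧ edist z q < r₂) {p : X} {R : NNReal} (hR : 0 < R)
    (h : ∀ r < R, IsCompact (Metric.closedEBall p (r : ℝ≥0∞))) :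
    IsCompact (Metric.closedEBall p (R : ℝ≥0∞)) := by
  refine isCompact_iff_totallyBounded_isComplete.2 ⟨?_, Metric.isClosed_closedEBall.isComplete⟩
  refine EMetric.totallyBounded_iff.2 fun ε hε => ?_
  have hε2 : 0 < ε / 2 := ENNReal.half_pos hε.ne'
  obtain ⟨δ, hδ0, hδ⟩ := ENNReal.lt_iff_exists_nnreal_btwn.1
    (lt_min (ENNReal.coe_pos.2 hR) hε2)
  have hδ0' : 0 < δ := by exact_mod_cast hδ0
  have hδR : δ < R := by exact_mod_cast hδ.trans_le (min_le_left _ _)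
  obtain ⟨t, ht, hcov⟩ := EMetric.totallyBounded_iff.1
    (h (R - δ) (tsub_lt_self hR hδ0')).totallyBounded (ε / 2) hε2
  refine ⟨t, ht, fun q hq => ?_⟩
  have hq' : edist p q ≤ R := by rw [edist_comm]; exact hq
  have h1 : edist p q < ((R - δ : NNReal) : ℝ≥0∞) + ε / 2 := by
    refine hq'.trans_lt ?_
    calc (R : ℝ≥0∞) = ((R - δ : NNReal) : ℝ≥0∞) + δ := by
          rw [← ENNReal.coe_add, tsub_add_cancel_of_le hδR.le]
      _ < _ := ENNReal.add_lt_add_left ENNReal.coe_ne_top (hδ.trans_le (min_le_right _ _))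
  obtain ⟨z, hz1, hz2⟩ := hlen p q _ _ (ENNReal.coe_pos.2 (tsub_pos_of_lt hδR)) hε2 h1
  have hz : z ∈ Metric.closedEBall p ((R - δ : NNReal) : ℝ≥0∞) := by
    rw [Metric.mem_closedEBall, edist_comm]; exact hz1.le
  obtain ⟨y, hy, hzy⟩ := mem_iUnion₂.1 (hcov hz)
  refine mem_iUnion₂.2 ⟨y, hy, ?_⟩
  rw [Metric.mem_eball] at hzy ⊢
  calc edist q y ≤ edist q z + edist z y := edist_triangle _ _ _
    _ < ε / 2 + ε / 2 := ENNReal.add_lt_add (by rwa [edist_comm]) hzy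
    _ = ε := ENNReal.add_halves ε

/-- The open half: a compact neighbourhood of the ball contains a thickening of it, and by the
length property that thickening contains a slightly larger ball. -/
lemma exists_lt_isCompact_closedEBall [WeaklyLocallyCompactSpace X]
    (hlen : ∀ (p q : X) (r₁ r₂ : ℝ≥0∞), 0 < r₁ → 0 < r₂ → edist p q < r₁ + r₂ →
      ∃ z, edist p z < r₁ ∧ edist z q < r₂) {p : X} {r : NNReal}
    (h : IsCompact (Metric.closedEBall p (r : ℝ≥0∞))) :
    ∃ s, r < s ∧ IsCompact (Metric.closedEBall p (s : ℝ≥0∞)) := by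
  obtain ⟨K, hK, hsub⟩ := exists_compact_superset h
  obtain ⟨δ, hδ, hthick⟩ := h.exists_cthickening_subset_open isOpen_interior hsub
  have hδ' : 0 < ENNReal.ofReal (δ / 2) := ENNReal.ofReal_pos.2 (half_pos hδ)
  refine ⟨r + (δ / 2).toNNReal, lt_add_of_pos_right _ (Real.toNNReal_pos.2 (half_pos hδ)),
    hK.of_isClosed_subset Metric.isClosed_closedEBall fun q hq => interior_subset (hthick ?_)⟩
  have hq' : edist p q ≤ r + ENNReal.ofReal (δ / 2) := by
    rw [edist_comm]; exact_mod_cast Metric.mem_closedEBall.1 hq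
  -- Radius zero is separate, because `hlen` needs positive radii.
  rcases eq_or_lt_of_le (zero_le (a := r)) with h0 | h0
  · refine Metric.mem_cthickening_of_edist_le q p δ _
      (Metric.mem_closedEBall_self) ?_
    rw [edist_comm]
    refine hq'.trans ?_
    rw [← h0, ENNReal.coe_zero, zero_add]
    exact ENNReal.ofReal_le_ofReal (by linarith)
  · have h1 : edist p q < r + ENNReal.ofReal δ := hq'.trans_lt
      (ENNReal.add_lt_add_left ENNReal.coe_ne_top
        ((ENNReal.ofReal_lt_ofReal_iff hδ).2 (by linarith)))
    obtain ⟨z, hz1, hz2⟩ := hlen p q _ _ (ENNReal.coe_pos.2 h0) (ENNReal.ofReal_pos.2 hδ) h1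
    refine Metric.mem_cthickening_of_edist_le q z δ _ ?_ ?_
    · rw [Metric.mem_closedEBall, edist_comm]; exact hz1.le
    · rw [edist_comm]; exact hz2.le

/-- **Hopf–Rinow**: in a complete locally compact length space, closed balls are compact. -/
theorem isCompact_closedEBall_of_length [CompleteSpace X] [WeaklyLocallyCompactSpace X]
    (hlen : ∀ (p q : X) (r₁ r₂ : ℝ≥0∞), 0 < r₁ → 0 < r₂ → edist p q < r₁ + r₂ →
      ∃ z, edist p z < r₁ ∧ edist z q < r₂) (p : X) (R : NNReal) :
    IsCompact (Metric.closedEBall p (R : ℝ≥0∞)) := by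
  by_contra hR
  -- If some ball is not compact, the radii of compact balls are bounded; their supremum is
  -- attained, yet can be exceeded.
  set T : Set NNReal := {r | IsCompact (Metric.closedEBall p (r : ℝ≥0∞))} with hT
  have h0 : (0 : NNReal) ∈ T := by simp [hT]
  have hbdd : BddAbove T := ⟨R, fun r hr => by
    by_contra! h
    exact hR (isCompact_closedEBall_mono h.le hr)⟩
  have hlt : ∀ r < sSup T, IsCompact (Metric.closedEBall p (r : ℝ≥0∞)) := fun r hr => by
    obtain ⟨s, hs, hrs⟩ := exists_lt_of_lt_csSup ⟨0, h0⟩ hr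
    exact isCompact_closedEBall_mono hrs.le hs
  have hsup : sSup T ∈ T := by
    rcases eq_or_lt_of_le (zero_le (a := sSup T)) with h | h
    · rwa [← h]
    · exact isCompact_closedEBall_of_lt hlen h hlt
  obtain ⟨s, hs, hcomp⟩ := exists_lt_isCompact_closedEBall hlen hsup
  exact absurd (le_csSup hbdd hcomp) (not_le.2 hs)

end HopfRinow

/-! ### Locally Lipschitz functions, Rademacher's theorem and integration by parts. -/

section LipschitzNear

open NNReal

/-- `f` is Lipschitz on a neighborhood of `x`. -/
def LipschitzNear {X Y : Type*} [PseudoEMetricSpace X] [PseudoEMetricSpace Y] (f : X → Y) (x : X) :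
    Prop :=
  ∃ K : ℝ≥0, ∃ s ∈ 𝓝 x, LipschitzOnWith K f s

variable {X Y Z : Type*} [PseudoEMetricSpace X] [PseudoEMetricSpace Y] [PseudoEMetricSpace Z]

lemma LipschitzNear.continuousAt {f : X → Y} {x : X} (hf : LipschitzNear f x) :
    ContinuousAt f x := by
  obtain ⟨K, s, hs, h⟩ := hf
  exact h.continuousOn.continuousAt hs

lemma LipschitzNear.comp {f : X → Y} {g : Y → Z} {x : X} (hg : LipschitzNear g (f x))
    (hf : LipschitzNear f x) : LipschitzNear (g ∘ f) x := by
  have hc := hf.continuousAt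
  obtain ⟨K, s, hs, h⟩ := hf
  obtain ⟨K', s', hs', h'⟩ := hg
  exact ⟨K' * K, s ∩ f ⁻¹' s', Filter.inter_mem hs (hc hs'),
    h'.comp (h.mono inter_subset_left) fun y hy => hy.2⟩

lemma LipschitzNear.prodMk {f : X → Y} {g : X → Z} {x : X} (hf : LipschitzNear f x)
    (hg : LipschitzNear g x) : LipschitzNear (fun y => (f y, g y)) x := by
  obtain ⟨K, s, hs, h⟩ := hf
  obtain ⟨K', s', hs', h'⟩ := hg
  exact ⟨max K K', s ∩ s', Filter.inter_mem hs hs',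
    (h.mono inter_subset_left).prodMk (h'.mono inter_subset_right)⟩

lemma LipschitzNear.congr {f g : X → Y} {x : X} (hf : LipschitzNear f x) (h : g =ᶠ[𝓝 x] f) :
    LipschitzNear g x := by
  obtain ⟨K, s, hs, h'⟩ := hf
  refine ⟨K, s ∩ {y | g y = f y}, Filter.inter_mem hs h, fun a ha b hb => ?_⟩
  rw [ha.2, hb.2]
  exact h' ha.1 hb.1

lemma lipschitzNear_of_lipschitzWith {f : X → Y} {K : ℝ≥0} (hf : LipschitzWith K f) (x : X) :
    LipschitzNear f x := ⟨K, univ, Filter.univ_mem, hf.lipschitzOnWith⟩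

lemma lipschitzNear_of_contDiffAt {V W : Type*} [NormedAddCommGroup V] [NormedSpace ℝ V]
    [NormedAddCommGroup W] [NormedSpace ℝ W] {f : V → W} {x : V} (hf : ContDiffAt ℝ ∞ f x) :
    LipschitzNear f x :=
  (hf.of_le (m := 1) (by simp)).exists_lipschitzOnWith

lemma LipschitzNear.mul {f g : X → ℝ} {x : X} (hf : LipschitzNear f x) (hg : LipschitzNear g x) :
    LipschitzNear (fun y => f y * g y) x :=
  LipschitzNear.comp (g := fun p : ℝ × ℝ => p.1 * p.2)
    (lipschitzNear_of_contDiffAt (contDiffAt_fst.mul contDiffAt_snd)) (hf.prodMk hg)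

lemma lineDeriv_eq_zero_of_notMem_tsupport {V : Type*} [NormedAddCommGroup V]
    [NormedSpace ℝ V] {h : V → ℝ} {x : V} (hx : x ∉ tsupport h) (v : V) :
    lineDeriv ℝ h x v = 0 := by
  have h1 : h =ᶠ[𝓝 x] fun _ => 0 := notMem_tsupport_iff_eventuallyEq.1 hx
  rw [h1.lineDeriv_eq]
  simp [lineDeriv]

variable {V : Type*} [NormedAddCommGroup V] [NormedSpace ℝ V] [FiniteDimensional ℝ V]

/-- On the compact `1`-neighbourhood of the support there is a uniform constant. A point outside it
is at distance at least `1` from the support, so there the sup bound of `h` serves as the constant.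
-/
lemma exists_lipschitzWith_of_hasCompactSupport {h : V → ℝ} (hl : ∀ x, LipschitzNear h x)
    (hs : HasCompactSupport h) : ∃ K : ℝ≥0, LipschitzWith K h := by
  have : ProperSpace V := FiniteDimensional.proper ℝ V
  have hK : IsCompact (Metric.cthickening 1 (tsupport h)) := IsCompact.cthickening hs
  obtain ⟨L, hL⟩ := LocallyLipschitzOn.exists_lipschitzOnWith_of_compact hK (f := h)
    fun x _ => by
      obtain ⟨K, s, hs, h'⟩ := hl x
      exact ⟨K, s, mem_nhdsWithin_of_mem_nhds hs, h'⟩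
  have hcont : Continuous h := continuous_iff_continuousAt.2 fun x => (hl x).continuousAt
  obtain ⟨B, hB⟩ := hcont.bounded_above_of_compact_support hs
  have hB0 : 0 ≤ B := (norm_nonneg _).trans (hB 0)
  have hfar : ∀ x ∈ tsupport h, ∀ y ∉ Metric.cthickening 1 (tsupport h),
      dist (h x) (h y) ≤ max (L : ℝ) B * dist x y := by
    intro x hx y hy
    have hy0 : h y = 0 := image_eq_zero_of_notMem_tsupport fun hyt =>
      hy (Metric.self_subset_cthickening _ hyt)
    have h1 : 1 ≤ dist x y := by
      by_contra! hlt
      exact hy (Metric.mem_cthickening_of_dist_le y x 1 _ hx (by rw [dist_comm]; exact hlt.le))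
    rw [hy0, dist_zero_right]
    calc ‖h x‖ ≤ B * 1 := by rw [mul_one]; exact hB x
      _ ≤ _ := mul_le_mul (le_max_right _ _) h1 zero_le_one (hB0.trans (le_max_right _ _))
  refine ⟨(max (L : ℝ) B).toNNReal, LipschitzWith.of_dist_le_mul fun x y => ?_⟩
  rw [Real.coe_toNNReal _ (hB0.trans (le_max_right _ _))]
  by_cases hx : x ∈ Metric.cthickening 1 (tsupport h)
  · by_cases hy : y ∈ Metric.cthickening 1 (tsupport h)
    · exact (hL.dist_le_mul x hx y hy).trans
        (mul_le_mul_of_nonneg_right (le_max_left _ _) dist_nonneg)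
    · by_cases hxt : x ∈ tsupport h
      · exact hfar x hxt y hy
      · rw [image_eq_zero_of_notMem_tsupport hxt, image_eq_zero_of_notMem_tsupport fun hyt =>
          hy (Metric.self_subset_cthickening _ hyt), dist_self]
        exact mul_nonneg (hB0.trans (le_max_right _ _)) dist_nonneg
  · by_cases hyt : y ∈ tsupport h
    · rw [dist_comm, dist_comm x y]
      exact hfar y hyt x hx
    · rw [image_eq_zero_of_notMem_tsupport hyt, image_eq_zero_of_notMem_tsupport fun hxt =>
        hx (Metric.self_subset_cthickening _ hxt), dist_self]
      exact mul_nonneg (hB0.trans (le_max_right _ _)) dist_nonneg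

variable [MeasurableSpace V] [BorelSpace V] {μ : Measure V} [μ.IsAddHaarMeasure]

/-- Integration by parts against the constant `1`. -/
lemma integral_lineDeriv_eq_zero {K : ℝ≥0} {h : V → ℝ} (hl : LipschitzWith K h)
    (hs : HasCompactSupport h) (v : V) : ∫ x, lineDeriv ℝ h x v ∂μ = 0 := by
  have h1 := LipschitzWith.integral_lineDeriv_mul_eq (μ := μ) (LipschitzWith.const (1 : ℝ)) hl hs (-v)
  simp only [neg_neg, mul_one] at h1
  rw [← h1]
  simp [lineDeriv]

lemma integrable_lineDeriv {K : ℝ≥0} {h : V → ℝ} (hl : LipschitzWith K h)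
    (hs : HasCompactSupport h) (v : V) : Integrable (fun x => lineDeriv ℝ h x v) μ := by
  have h1 : IntegrableOn (fun x => lineDeriv ℝ h x v) (tsupport h) μ :=
    (hl.locallyIntegrable_lineDeriv v).integrableOn_isCompact hs
  exact (integrableOn_iff_integrable_of_support_subset fun x hx => by
    by_contra hxt
    exact hx (lineDeriv_eq_zero_of_notMem_tsupport hxt v)).1 h1

lemma ae_differentiableAt_of_lipschitzNear {h : V → ℝ} {T : Set V}
    (hl : ∀ x ∈ T, LipschitzNear h x) : ∀ᵐ x ∂μ, x ∈ T → DifferentiableAt ℝ h x := by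
  rw [ae_iff]
  refine measure_null_of_locally_null _ fun x hx => ?_
  simp only [Classical.not_imp, mem_ofPred_eq] at hx
  obtain ⟨K, s, hs, h'⟩ := hl x hx.1
  obtain ⟨o, hos, ho, hxo⟩ := mem_nhds_iff.1 hs
  have h1 := (h'.mono hos).ae_differentiableWithinAt_of_mem (μ := μ)
  refine ⟨{y | ¬ (y ∈ o → DifferentiableWithinAt ℝ h o y)}, ?_, ae_iff.1 h1⟩
  refine mem_nhdsWithin.2 ⟨o, ho, hxo, fun y hy => ?_⟩
  simp only [mem_inter_iff, mem_ofPred_eq, Classical.not_imp] at hy ⊢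
  exact ⟨hy.1, fun hd => hy.2.2 (hd.differentiableAt (ho.mem_nhds hy.1))⟩

end LipschitzNear

/-! ### The divergence theorem in one chart. -/

section ChartDivergence

variable {n m : ℕ} {f : EuclideanSpace ℝ (Fin n) → EuclideanSpace ℝ (Fin m)}
  {T : Set (EuclideanSpace ℝ (Fin n))} {ζ : EuclideanSpace ℝ (Fin n) → ℝ}

/-- The divergence of `ζ` times the tangential part of the position vector. -/
def chartDiv (f : EuclideanSpace ℝ (Fin n) → EuclideanSpace ℝ (Fin m))
    (x₀ : EuclideanSpace ℝ (Fin m)) (ζ : EuclideanSpace ℝ (Fin n) → ℝ)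
    (u : EuclideanSpace ℝ (Fin n)) : ℝ :=
  ∑ i, lineDeriv ℝ (fun v => √(inducedMetric f v).det * tangentCoord f v (f v - x₀) i * ζ v) u
    (EuclideanSpace.single i 1)

lemma chartDiv_eq {u : EuclideanSpace ℝ (Fin n)} (hf : ContDiffAt ℝ ∞ f u)
    (h : Function.Injective (fderiv ℝ f u)) (hζ : DifferentiableAt ℝ ζ u)
    (x₀ : EuclideanSpace ℝ (Fin m)) :
    chartDiv f x₀ ζ u = √(inducedMetric f u).det * divIntegrand f x₀ ζ u := by
  have hd : ∀ i, DifferentiableAt ℝ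
      (fun v => √(inducedMetric f v).det * tangentCoord f v (f v - x₀) i) u := fun i =>
    ((contDiffAt_sqrt_det hf h).mul (contDiffAt_tangentCoord hf h x₀ i)).differentiableAt (by simp)
  have h1 : ∀ i, lineDeriv ℝ (fun v => √(inducedMetric f v).det *
      tangentCoord f v (f v - x₀) i * ζ v) u (EuclideanSpace.single i 1) =
      √(inducedMetric f u).det * tangentCoord f u (f u - x₀) i *
        fderiv ℝ ζ u (EuclideanSpace.single i 1) + ζ u * fderiv ℝ (fun v =>
        √(inducedMetric f v).det * tangentCoord f v (f v - x₀) i) u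
          (EuclideanSpace.single i 1) := by
    intro i
    rw [((hd i).fun_mul hζ).lineDeriv_eq_fderiv, fderiv_fun_mul (hd i) hζ]
    simp
  rw [chartDiv, Finset.sum_congr rfl fun i _ => h1 i, Finset.sum_add_distrib, ← Finset.mul_sum,
    sum_fderiv_tangentCoord hf h, divIntegrand, map_eq_sum_single _ (tangentCoord f u (f u - x₀))]
  simp_rw [smul_eq_mul, mul_assoc, ← Finset.mul_sum]
  ring

variable (hf : ∀ u ∈ T, ContDiffAt ℝ ∞ f u) (hinj : ∀ u ∈ T, Function.Injective (fderiv ℝ f u))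
  (hζ : ∀ u ∈ T, LipschitzNear ζ u) (hζs : HasCompactSupport ζ) (hζT : tsupport ζ ⊆ T)
  (x₀ : EuclideanSpace ℝ (Fin m))

include hf hinj hζ hζs hζT

/-- The field is controlled only on `T`, but the factor `ζ` vanishes near every point outside `T`,
so the product is Lipschitz on the whole space. -/
lemma exists_lipschitzWith_mul_tangentCoord (i : Fin n) :
    ∃ K : NNReal, LipschitzWith K
      fun v => √(inducedMetric f v).det * tangentCoord f v (f v - x₀) i * ζ v := by
  refine exists_lipschitzWith_of_hasCompactSupport (fun u => ?_) hζs.mul_left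
  by_cases hu : u ∈ T
  · exact (lipschitzNear_of_contDiffAt ((contDiffAt_sqrt_det (hf u hu) (hinj u hu)).mul
      (contDiffAt_tangentCoord (hf u hu) (hinj u hu) x₀ i))).mul (hζ u hu)
  · refine (lipschitzNear_of_lipschitzWith (LipschitzWith.const (0 : ℝ)) u).congr ?_
    filter_upwards [notMem_tsupport_iff_eventuallyEq.1 fun h => hu (hζT h)] with v hv
    simp [hv]

lemma measurable_chartDiv : Measurable (chartDiv f x₀ ζ) := by
  refine Finset.measurable_sum _ fun i _ => ?_
  obtain ⟨K, hK⟩ := exists_lipschitzWith_mul_tangentCoord hf hinj hζ hζs hζT x₀ i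
  exact measurable_lineDeriv hK.continuous

lemma integrable_chartDiv : Integrable (chartDiv f x₀ ζ) := by
  refine integrable_finsetSum _ fun i _ => ?_
  obtain ⟨K, hK⟩ := exists_lipschitzWith_mul_tangentCoord hf hinj hζ hζs hζT x₀ i
  exact integrable_lineDeriv hK hζs.mul_left _

lemma integral_chartDiv : ∫ u, chartDiv f x₀ ζ u = 0 := by
  have hi : ∀ i, ∃ K : NNReal, LipschitzWith K
      fun v => √(inducedMetric f v).det * tangentCoord f v (f v - x₀) i * ζ v :=
    exists_lipschitzWith_mul_tangentCoord hf hinj hζ hζs hζT x₀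
  simp only [chartDiv]
  rw [integral_finsetSum _ fun i _ => ?_]
  · refine Finset.sum_eq_zero fun i _ => ?_
    obtain ⟨K, hK⟩ := hi i
    exact integral_lineDeriv_eq_zero hK hζs.mul_left _
  · obtain ⟨K, hK⟩ := hi i
    exact integrable_lineDeriv hK hζs.mul_left _

omit hf hinj hζ hζs in
lemma chartDiv_eq_zero {u : EuclideanSpace ℝ (Fin n)} (hu : u ∉ T) : chartDiv f x₀ ζ u = 0 := by
  refine Finset.sum_eq_zero fun i _ => lineDeriv_eq_zero_of_notMem_tsupport (fun h => hu ?_) _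
  exact hζT (tsupport_mul_subset_right h)

end ChartDivergence

/-! ### The first variation formula on the manifold. -/

section FirstVariation

variable {n m : ℕ} {M : Type*} [TopologicalSpace M] [ChartedSpace (EuclideanSpace ℝ (Fin n)) M]
  {F : M → EuclideanSpace ℝ (Fin m)}

/-- The integrand of the first variation formula for the position vector field `F - x₀` tested with
the function `η`: `(n + ⟪H, F - x₀⟫) η + dη ((F - x₀)ᵀ)`. -/
def firstVariation (n : ℕ) {m : ℕ} {M : Type*} [TopologicalSpace M]
    [ChartedSpace (EuclideanSpace ℝ (Fin n)) M] (F : M → EuclideanSpace ℝ (Fin m))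
    (x₀ : EuclideanSpace ℝ (Fin m)) (η : M → ℝ) (q : M) : ℝ :=
  divIntegrand (localParam n F q) x₀ (fun u => η ((extChartAt (𝓡 n) q).symm u))
    (extChartAt (𝓡 n) q q)

/-- `η` is locally Lipschitz in every chart. -/
def ChartLipschitz (n : ℕ) {M : Type*} [TopologicalSpace M]
    [ChartedSpace (EuclideanSpace ℝ (Fin n)) M] (η : M → ℝ) : Prop :=
  ∀ x : M, ∀ u ∈ (extChartAt (𝓡 n) x).target,
    LipschitzNear (fun u => η ((extChartAt (𝓡 n) x).symm u)) u

/-- `η` is differentiable at `q` in the chart at `q`. -/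
def ChartDifferentiableAt (n : ℕ) {M : Type*} [TopologicalSpace M]
    [ChartedSpace (EuclideanSpace ℝ (Fin n)) M] (η : M → ℝ) (q : M) : Prop :=
  DifferentiableAt ℝ (fun u => η ((extChartAt (𝓡 n) q).symm u)) (extChartAt (𝓡 n) q q)

lemma transition_apply_self (x q : M) :
    (extChartAt (𝓡 n) x ∘ (extChartAt (𝓡 n) q).symm) (extChartAt (𝓡 n) q q) =
      extChartAt (𝓡 n) x q := by
  rw [Function.comp_apply, extChartAt_to_inv]

lemma transition_source {x q : M} (hq : q ∈ (extChartAt (𝓡 n) x).source) :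
    (extChartAt (𝓡 n) q).symm (extChartAt (𝓡 n) q q) ∈ (extChartAt (𝓡 n) x).source := by
  rwa [extChartAt_to_inv]

variable [IsManifold (𝓡 n) ∞ M]

lemma chartDifferentiableAt_of_mem_source {η : M → ℝ} {x q : M}
    (hq : q ∈ (extChartAt (𝓡 n) x).source)
    (h : DifferentiableAt ℝ (fun u => η ((extChartAt (𝓡 n) x).symm u)) (extChartAt (𝓡 n) x q)) :
    ChartDifferentiableAt n η q := by
  have hu := mem_extChartAt_target (I := 𝓡 n) q
  have hq' := transition_source hq
  have he := comp_symm_eventuallyEq (n := n) η hu hq'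
  rw [ChartDifferentiableAt, he.differentiableAt_iff]
  rw [← transition_apply_self x q] at h
  exact h.comp _ ((contDiffAt_transition hu hq').differentiableAt (by simp))

lemma ChartDifferentiableAt.differentiableAt {η : M → ℝ} {x q : M}
    (hq : q ∈ (extChartAt (𝓡 n) x).source) (h : ChartDifferentiableAt n η q) :
    DifferentiableAt ℝ (fun u => η ((extChartAt (𝓡 n) x).symm u)) (extChartAt (𝓡 n) x q) := by
  have hu := (extChartAt (𝓡 n) x).map_source hq
  have hq' : (extChartAt (𝓡 n) x).symm (extChartAt (𝓡 n) x q) ∈ (extChartAt (𝓡 n) q).source := by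
    rw [(extChartAt (𝓡 n) x).left_inv hq]; exact mem_extChartAt_source q
  have he := comp_symm_eventuallyEq (n := n) η hu hq'
  rw [he.differentiableAt_iff]
  refine DifferentiableAt.comp _ ?_ ((contDiffAt_transition hu hq').differentiableAt (by simp))
  rw [Function.comp_apply, (extChartAt (𝓡 n) x).left_inv hq]
  exact h

variable (hF : ContMDiff (𝓡 n) (𝓡 m) ∞ F)
  (hinj : ∀ x : M, ∀ u ∈ (extChartAt (𝓡 n) x).target,
    Function.Injective (fderiv ℝ (localParam n F x) u))

include hF hinj in
-- `firstVariation` reads each point in its own chart; to integrate it, it has to be expressed in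
-- one fixed chart.
lemma firstVariation_eq_of_mem_source {η : M → ℝ} {x q : M}
    (hq : q ∈ (extChartAt (𝓡 n) x).source)
    (h : DifferentiableAt ℝ (fun u => η ((extChartAt (𝓡 n) x).symm u)) (extChartAt (𝓡 n) x q))
    (x₀ : EuclideanSpace ℝ (Fin m)) :
    firstVariation n F x₀ η q = divIntegrand (localParam n F x) x₀
      (fun u => η ((extChartAt (𝓡 n) x).symm u)) (extChartAt (𝓡 n) x q) := by
  have hu := mem_extChartAt_target (I := 𝓡 n) q
  have hq' := transition_source hq
  have hT := (extChartAt (𝓡 n) x).map_source hq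
  rw [← transition_apply_self x q] at h hT ⊢
  exact divIntegrand_comp (contDiffAt_localParam hF hT) (contDiffAt_transition hu hq')
    (comp_symm_eventuallyEq F hu hq') (hinj x _ hT) (hinj q _ hu) h
    (comp_symm_eventuallyEq η hu hq') x₀

omit [IsManifold (𝓡 n) ∞ M] in
lemma firstVariation_eq_zero {η : M → ℝ} {q : M} (hq : q ∉ tsupport η)
    (x₀ : EuclideanSpace ℝ (Fin m)) : firstVariation n F x₀ η q = 0 := by
  have h0 : η =ᶠ[𝓝 q] fun _ => 0 := notMem_tsupport_iff_eventuallyEq.1 hq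
  have hc : Filter.Tendsto (extChartAt (𝓡 n) q).symm (𝓝 (extChartAt (𝓡 n) q q)) (𝓝 q) := by
    have := continuousAt_extChartAt_symm (I := 𝓡 n) q
    rwa [ContinuousAt, extChartAt_to_inv] at this
  have h1 : (fun u => η ((extChartAt (𝓡 n) q).symm u)) =ᶠ[𝓝 (extChartAt (𝓡 n) q q)]
      fun _ => 0 := hc.eventually h0
  rw [firstVariation, divIntegrand, h1.fderiv_eq, h1.eq_of_nhds]
  simp

omit [IsManifold (𝓡 n) ∞ M] in
lemma firstVariation_sum {ι : Type*} (t : Finset ι) {η : ι → M → ℝ} {q : M}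
    (h : ∀ i ∈ t, ChartDifferentiableAt n (η i) q) (x₀ : EuclideanSpace ℝ (Fin m)) :
    firstVariation n F x₀ (fun p => ∑ i ∈ t, η i p) q = ∑ i ∈ t, firstVariation n F x₀ (η i) q := by
  simp only [firstVariation, divIntegrand]
  rw [Finset.sum_add_distrib, fderiv_fun_sum h, ← Finset.mul_sum, sum_apply]

variable [MeasurableSpace M] [BorelSpace M]

omit [IsManifold (𝓡 n) ∞ M] in
lemma measurableSet_source_inter_preimage (x : M) {N : Set (EuclideanSpace ℝ (Fin n))}
    (hN : MeasurableSet N) :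
    MeasurableSet ((extChartAt (𝓡 n) x).source ∩ extChartAt (𝓡 n) x ⁻¹' N) := by
  have h := MeasurableSet.subtype_image (isOpen_extChartAt_source (I := 𝓡 n) x).measurableSet
    ((continuousOn_extChartAt (I := 𝓡 n) x).domRestrict.measurable hN)
  convert h using 1
  ext v
  simp [and_comm]

omit [IsManifold (𝓡 n) ∞ M] in
lemma ae_chartArea_of_ae (x : M) {P : M → Prop}
    (h : ∀ᵐ u : EuclideanSpace ℝ (Fin n), u ∈ (extChartAt (𝓡 n) x).target →
      P ((extChartAt (𝓡 n) x).symm u)) : ∀ᵐ q ∂(chartArea n F x), P q := by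
  rw [ae_iff] at h ⊢
  -- `P` need not be measurable, so the exceptional set is replaced by a measurable null hull.
  set N := toMeasurable volume {u : EuclideanSpace ℝ (Fin n) |
    ¬ (u ∈ (extChartAt (𝓡 n) x).target → P ((extChartAt (𝓡 n) x).symm u))} with hN
  have hN0 : volume N = 0 := by rw [hN, measure_toMeasurable]; exact h
  rw [← chartArea_inter_source]
  refine measure_mono_null (t := (extChartAt (𝓡 n) x).source ∩ extChartAt (𝓡 n) x ⁻¹' N) ?_ ?_
  · rintro q ⟨hq, hqs⟩
    refine ⟨hqs, subset_toMeasurable _ _ ?_⟩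
    simp only [mem_ofPred_eq, Classical.not_imp]
    refine ⟨(extChartAt (𝓡 n) x).map_source hqs, ?_⟩
    rw [(extChartAt (𝓡 n) x).left_inv hqs]
    exact hq
  · rw [chartArea_apply x (measurableSet_source_inter_preimage x (measurableSet_toMeasurable _ _))]
    refine setLIntegral_measure_zero _ _ (measure_mono_null ?_ hN0)
    rintro u ⟨⟨_, hu⟩, huT⟩
    rwa [mem_preimage, (extChartAt (𝓡 n) x).right_inv huT] at hu

omit [IsManifold (𝓡 n) ∞ M] in
lemma integral_comp_extChartAt (x : M) {g : EuclideanSpace ℝ (Fin n) → ℝ} (hg : Measurable g)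
    (hi : IntegrableOn (fun u => chartDensity n F x u * g u) (extChartAt (𝓡 n) x).target) :
    Integrable (fun q => g (extChartAt (𝓡 n) x q)) (chartArea n F x) ∧
    ∫ q, g (extChartAt (𝓡 n) x q) ∂(chartArea n F x) =
      ∫ u in (extChartAt (𝓡 n) x).target, chartDensity n F x u * g u := by
  have hwm : Measurable fun u => ENNReal.ofReal (chartDensity n F x u) :=
    (measurable_chartDensity x).ennreal_ofReal
  have hφ : AEMeasurable (extChartAt (𝓡 n) x) (chartArea n F x) := by
    have h1 : (chartArea n F x).restrict (extChartAt (𝓡 n) x).source = chartArea n F x :=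
      Measure.restrict_eq_self_of_ae_mem (ae_iff.2 (chartArea_compl_source x))
    rw [← h1]
    exact (continuousOn_extChartAt x).aemeasurable (isOpen_extChartAt_source x).measurableSet
  have hgm : AEStronglyMeasurable (fun q => g (extChartAt (𝓡 n) x q)) (chartArea n F x) :=
    (hg.comp_aemeasurable hφ).aestronglyMeasurable
  have hsymm := aemeasurable_extChartAt_symm (n := n) (F := F) x
  have hae : ∀ᵐ u ∂(((volume : Measure (EuclideanSpace ℝ (Fin n))).restrict
      (extChartAt (𝓡 n) x).target).withDensity fun u => ENNReal.ofReal (chartDensity n F x u)),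
      g (extChartAt (𝓡 n) x ((extChartAt (𝓡 n) x).symm u)) = g u := by
    refine (withDensity_absolutelyContinuous _ _).ae_le ?_
    filter_upwards [ae_restrict_mem (isOpen_extChartAt_target x).measurableSet] with u hu
    rw [(extChartAt (𝓡 n) x).right_inv hu]
  have htr : ∀ u, (ENNReal.ofReal (chartDensity n F x u)).toReal • g u =
      chartDensity n F x u * g u := fun u => by
    rw [ENNReal.toReal_ofReal (show 0 ≤ chartDensity n F x u from Real.sqrt_nonneg _), smul_eq_mul]
  constructor
  · refine (integrable_map_measure hgm hsymm).2 ?_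
    refine (integrable_congr hae).2 ?_
    rw [integrable_withDensity_iff_integrable_smul' hwm (by simp)]
    simp only [htr]
    exact hi
  · refine (integral_map hsymm hgm).trans ?_
    rw [integral_congr_ae hae, integral_withDensity_eq_integral_toReal_smul hwm (by simp)]
    simp only [htr]

variable {ν : Measure M}
  (hν : ∀ x, ν.restrict (extChartAt (𝓡 n) x).source = chartArea n F x)

include hν in
lemma ae_chartDifferentiableAt [SecondCountableTopology M] {η : M → ℝ}
    (hη : ChartLipschitz n η) : ∀ᵐ q ∂ν, ChartDifferentiableAt n η q := by
  rw [ae_iff]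
  refine measure_null_of_locally_null _ fun x _ => ?_
  have h1 : ∀ᵐ q ∂ν.restrict (extChartAt (𝓡 n) x).source, q ∈ (extChartAt (𝓡 n) x).source →
      ChartDifferentiableAt n η q := by
    rw [hν]
    refine ae_chartArea_of_ae x ?_
    filter_upwards [ae_differentiableAt_of_lipschitzNear (μ := volume) (hη x)] with u hu huT _
    refine chartDifferentiableAt_of_mem_source ((extChartAt (𝓡 n) x).map_target huT) ?_
    rw [(extChartAt (𝓡 n) x).right_inv huT]
    exact hu huT
  rw [ae_restrict_iff' (isOpen_extChartAt_source x).measurableSet] at h1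
  refine ⟨{q | ¬ ChartDifferentiableAt n η q} ∩ (extChartAt (𝓡 n) x).source,
    inter_mem_nhdsWithin _ (extChartAt_source_mem_nhds x), ?_⟩
  rw [ae_iff] at h1
  convert h1 using 2
  ext q
  simp [and_comm]

include hF hinj hν in
lemma integral_firstVariation_of_subset_source [T2Space M] [SecondCountableTopology M] {η : M → ℝ}
    (hη : ChartLipschitz n η) (hs : HasCompactSupport η) {x : M}
    (hx : tsupport η ⊆ (extChartAt (𝓡 n) x).source) (x₀ : EuclideanSpace ℝ (Fin m)) :
    Integrable (firstVariation n F x₀ η) ν ∧ ∫ q, firstVariation n F x₀ η q ∂ν = 0 := by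
  set φ := extChartAt (𝓡 n) x with hφ
  have hTo : IsOpen φ.target := isOpen_extChartAt_target x
  have hSo : IsOpen φ.source := isOpen_extChartAt_source x
  -- Extension by zero, as the values of `φ.symm` off the target are arbitrary.
  set ζ : EuclideanSpace ℝ (Fin n) → ℝ := φ.target.indicator fun u => η (φ.symm u) with hζ
  have hK : IsCompact (φ '' tsupport η) :=
    IsCompact.image_of_continuousOn hs ((continuousOn_extChartAt x).mono hx)
  have hsub : Function.support ζ ⊆ φ '' tsupport η := by
    intro u hu
    have huT : u ∈ φ.target := by
      by_contra h
      exact hu (indicator_of_notMem h _)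
    refine ⟨φ.symm u, subset_tsupport _ ?_, φ.right_inv huT⟩
    rwa [Function.mem_support, hζ, indicator_of_mem huT] at hu
  have htsub : tsupport ζ ⊆ φ '' tsupport η := closure_minimal hsub hK.isClosed
  have hζs : HasCompactSupport ζ := hK.of_isClosed_subset (isClosed_tsupport _) htsub
  have hζT : tsupport ζ ⊆ φ.target := htsub.trans fun _ ⟨q, hq, h⟩ => h ▸ φ.map_source (hx hq)
  have hζeq : ∀ u ∈ φ.target, ζ =ᶠ[𝓝 u] fun u => η (φ.symm u) := fun u hu => by
    filter_upwards [hTo.mem_nhds hu] with v hv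
    rw [hζ, indicator_of_mem hv]
  have hζl : ∀ u ∈ φ.target, LipschitzNear ζ u := fun u hu => (hη x u hu).congr (hζeq u hu)
  have hfd : ∀ u ∈ φ.target, ContDiffAt ℝ ∞ (localParam n F x) u := fun u hu =>
    contDiffAt_localParam hF hu
  set D := chartDiv (localParam n F x) x₀ ζ with hD
  have hDm : Measurable D := measurable_chartDiv hfd (hinj x) hζl hζs hζT x₀
  have hDi : Integrable D := integrable_chartDiv hfd (hinj x) hζl hζs hζT x₀
  have hD0 : ∫ u, D u = 0 := integral_chartDiv hfd (hinj x) hζl hζs hζT x₀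
  have hw : ∀ u ∈ φ.target, 0 < chartDensity n F x u := fun u hu =>
    Real.sqrt_pos.2 (inducedMetric_det_pos (hinj x u hu))
  -- `D` is the density times the integrand (`chartDiv_eq`), so `D / chartDensity` is the integrand
  -- on the manifold, and the area measure restores the density.
  have hcancel : EqOn (fun u => chartDensity n F x u * (D u / chartDensity n F x u)) D φ.target :=
    fun u hu => mul_div_cancel₀ _ (hw u hu).ne'
  have hDT : ∫ u in φ.target, D u = 0 := by
    rw [setIntegral_eq_integral_of_forall_compl_eq_zero fun u hu => chartDiv_eq_zero hζT x₀ hu]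
    exact hD0
  obtain ⟨hint, hval⟩ := integral_comp_extChartAt (F := F) x
    (hDm.div (measurable_chartDensity (n := n) (F := F) x))
    ((integrableOn_congr_fun hcancel hTo.measurableSet).2 hDi.integrableOn)
  replace hval := hval.trans ((setIntegral_congr_fun hTo.measurableSet hcancel).trans hDT)
  have hae : ∀ᵐ q ∂ν.restrict φ.source, firstVariation n F x₀ η q =
      D (φ q) / chartDensity n F x (φ q) := by
    rw [hν]
    have h1 : ∀ᵐ q ∂(chartArea n F x), q ∈ φ.source → firstVariation n F x₀ η q =
        D (φ q) / chartDensity n F x (φ q) := by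
      refine ae_chartArea_of_ae x ?_
      filter_upwards [ae_differentiableAt_of_lipschitzNear (μ := volume) (hη x)] with u hu huT hus
      have hr := φ.right_inv huT
      have hd := hu huT
      rw [firstVariation_eq_of_mem_source hF hinj hus (by rw [hr]; exact hd), ← hφ, hr, hD,
        chartDiv_eq (hfd u huT) (hinj x u huT) ((hζeq u huT).differentiableAt_iff.2 hd)]
      rw [eq_div_iff (hw u huT).ne', mul_comm]
      congr 1
      rw [divIntegrand, divIntegrand, (hζeq u huT).fderiv_eq, (hζeq u huT).eq_of_nhds]
    filter_upwards [h1, ae_iff.2 (chartArea_compl_source (F := F) x)] with q h2 h3 using h2 h3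
  have hzero : ∀ q ∉ φ.source, firstVariation n F x₀ η q = 0 := fun q hq =>
    firstVariation_eq_zero (fun h => hq (hx h)) x₀
  constructor
  · rw [← integrableOn_iff_integrable_of_support_subset (s := φ.source)
      fun q hq => by_contra fun h => hq (hzero q h)]
    refine (integrable_congr hae).2 ?_
    rw [hν]
    exact hint
  · rw [← setIntegral_eq_integral_of_forall_compl_eq_zero (s := φ.source) hzero,
      integral_congr_ae hae, hν]
    exact hval

omit [MeasurableSpace M] [BorelSpace M] in
lemma contMDiff_chartLipschitz {χ : M → ℝ} (hχ : ContMDiff (𝓡 n) 𝓘(ℝ, ℝ) ∞ χ) :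
    ChartLipschitz n χ := by
  intro x u hu
  refine lipschitzNear_of_contDiffAt ?_
  rw [← contMDiffAt_iff_contDiffAt]
  have h1 : ContMDiffAt 𝓘(ℝ, EuclideanSpace ℝ (Fin n)) (𝓡 n) ∞ (extChartAt (𝓡 n) x).symm u :=
    (contMDiffOn_extChartAt_symm x).contMDiffAt ((isOpen_extChartAt_target x).mem_nhds hu)
  exact (hχ.contMDiffAt (x := (extChartAt (𝓡 n) x).symm u)).comp u h1

include hF hinj hν in
/-- **First variation formula** for the position vector field, tested with a compactly supported
Lipschitz function. -/
theorem integral_firstVariation [T2Space M] [SecondCountableTopology M] {η : M → ℝ}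
    (hη : ChartLipschitz n η) (hs : HasCompactSupport η) (x₀ : EuclideanSpace ℝ (Fin m)) :
    Integrable (firstVariation n F x₀ η) ν ∧ ∫ q, firstVariation n F x₀ η q ∂ν = 0 := by
  have : LocallyCompactSpace M := Manifold.locallyCompact_of_finiteDimensional (𝓡 n)
  obtain ⟨χ, hχ⟩ := SmoothPartitionOfUnity.exists_isSubordinate (𝓡 n) (s := tsupport η)
    (isClosed_tsupport η) (fun x : M => (extChartAt (𝓡 n) x).source)
    (fun x => isOpen_extChartAt_source x)
    fun x _ => mem_iUnion.2 ⟨x, mem_extChartAt_source x⟩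
  have hfin := χ.locallyFinite.finite_nonempty_inter_compact hs
  set t := hfin.toFinset with ht
  have hsum : ∀ q, η q = ∑ i ∈ t, χ i q * η q := by
    intro q
    rw [← Finset.sum_mul]
    by_cases hq : q ∈ tsupport η
    · have h1 := χ.sum_eq_one hq
      rw [finsum_eq_sum_of_support_subset (s := t)] at h1
      · rw [h1, one_mul]
      · intro i hi
        simp only [ht, Set.Finite.coe_toFinset, mem_ofPred_eq]
        exact ⟨q, hi, hq⟩
    · rw [image_eq_zero_of_notMem_tsupport hq, mul_zero]
  have hl : ∀ i, ChartLipschitz n fun q => χ i q * η q := fun i x u hu =>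
    (contMDiff_chartLipschitz (χ i).contMDiff x u hu).mul (hη x u hu)
  have hi : ∀ i, Integrable (firstVariation n F x₀ fun q => χ i q * η q) ν ∧
      ∫ q, firstVariation n F x₀ (fun q => χ i q * η q) q ∂ν = 0 := fun i =>
    integral_firstVariation_of_subset_source hF hinj hν (hl i) hs.mul_left
      (tsupport_mul_subset_left.trans (hχ i)) x₀
  -- Additivity holds only a.e.: the pieces are merely Lipschitz, and `fderiv` is additive only
  -- where they are differentiable.
  have hae : firstVariation n F x₀ η =ᵐ[ν]
      fun q => ∑ i ∈ t, firstVariation n F x₀ (fun q => χ i q * η q) q := by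
    have h1 : ∀ i ∈ t, ∀ᵐ q ∂ν, ChartDifferentiableAt n (fun q => χ i q * η q) q := fun i _ =>
      ae_chartDifferentiableAt hν (hl i)
    filter_upwards [(Finset.eventually_all t).2 h1] with q hq
    rw [← firstVariation_sum t hq]
    congr 1
    exact funext hsum
  constructor
  · exact (integrable_congr hae).2 (integrable_finsetSum _ fun i _ => (hi i).1)
  · rw [integral_congr_ae hae, integral_finsetSum _ fun i _ => (hi i).1]
    exact Finset.sum_eq_zero fun i _ => (hi i).2

end FirstVariation

/-! ### Area of small intrinsic balls. -/

section LowerDensity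

variable {n m : ℕ}

lemma inducedMetric_id (u : EuclideanSpace ℝ (Fin n)) :
    inducedMetric (id : EuclideanSpace ℝ (Fin n) → EuclideanSpace ℝ (Fin n)) u = 1 := by
  ext i j
  simp only [inducedMetric, partialDeriv, Matrix.of_apply, fderiv_id, ContinuousLinearMap.id_apply]
  rw [EuclideanSpace.inner_single_left, Matrix.one_apply]
  simp

/-- An orthonormal basis of the tangent space turns `df` into an endomorphism `S` with `Sᵀ S = G`,
to which determinants and volume scaling apply. -/
lemma exists_linearMap_norm_eq {f : EuclideanSpace ℝ (Fin n) → EuclideanSpace ℝ (Fin m)}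
    {u : EuclideanSpace ℝ (Fin n)} (h : Function.Injective (fderiv ℝ f u)) :
    ∃ S : EuclideanSpace ℝ (Fin n) →L[ℝ] EuclideanSpace ℝ (Fin n),
      (∀ w, ‖S w‖ = ‖fderiv ℝ f u w‖) ∧ |S.det| = √(inducedMetric f u).det := by
  set L := fderiv ℝ f u with hL
  have hrank : Module.finrank ℝ (LinearMap.range L.toLinearMap) = n := by
    rw [LinearMap.finrank_range_of_inj h, finrank_euclideanSpace_fin]
  let b := (stdOrthonormalBasis ℝ (LinearMap.range L.toLinearMap)).reindex (finCongr hrank)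
  let S₀ : EuclideanSpace ℝ (Fin n) →ₗ[ℝ] EuclideanSpace ℝ (Fin n) :=
    b.repr.toLinearEquiv.toLinearMap ∘ₗ L.toLinearMap.rangeRestrict
  let S : EuclideanSpace ℝ (Fin n) →L[ℝ] EuclideanSpace ℝ (Fin n) := LinearMap.toContinuousLinearMap S₀
  have hS : ∀ v, S v = b.repr (L.toLinearMap.rangeRestrict v) := fun v => rfl
  have hin : ∀ v w, inner ℝ (S v) (S w) = inner ℝ (L v) (L w) := by
    intro v w
    rw [hS, hS, LinearIsometryEquiv.inner_map_map]
    rfl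
  refine ⟨S, fun w => ?_, ?_⟩
  · rw [norm_eq_sqrt_real_inner, norm_eq_sqrt_real_inner, hin]
  · have h1 := det_inducedMetric_comp (f := id) (f' := S) (ψ := S) (u := 0) differentiableAt_id
      S.differentiableAt Filter.EventuallyEq.rfl
    rw [inducedMetric_id, Matrix.det_one, Real.sqrt_one, mul_one,
      ContinuousLinearMap.fderiv] at h1
    rw [← h1]
    congr 2
    ext i j
    simp only [inducedMetric, partialDeriv, Matrix.of_apply, ContinuousLinearMap.fderiv]
    exact hin _ _

/-- The ellipsoid is a translate of the preimage under `S` of a round ball; `|det S|` cancels the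
density, so the answer does not depend on the chart. -/
lemma volume_ellipsoid {f : EuclideanSpace ℝ (Fin n) → EuclideanSpace ℝ (Fin m)}
    {u : EuclideanSpace ℝ (Fin n)} (h : Function.Injective (fderiv ℝ f u)) {r : ℝ} (hr : 0 < r) :
    ENNReal.ofReal √(inducedMetric f u).det * volume {v | ‖fderiv ℝ f u (v - u)‖ < r} =
      ENNReal.ofReal (r ^ n) *
        volume (Metric.ball (0 : EuclideanSpace ℝ (Fin n)) 1) := by
  obtain ⟨S, hS, hdet⟩ := exists_linearMap_norm_eq h
  have hpos : 0 < √(inducedMetric f u).det := Real.sqrt_pos.2 (inducedMetric_det_pos h)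
  have hne : LinearMap.det (S : EuclideanSpace ℝ (Fin n) →ₗ[ℝ] EuclideanSpace ℝ (Fin n)) ≠ 0 := by
    intro h0
    rw [← hdet] at hpos
    exact (abs_pos.1 hpos) h0
  have hset : {v | ‖fderiv ℝ f u (v - u)‖ < r} =
      (fun v => v + -u) ⁻¹' ((S : EuclideanSpace ℝ (Fin n) →ₗ[ℝ] EuclideanSpace ℝ (Fin n)) ⁻¹'
        Metric.ball 0 r) := by
    ext v
    simp only [mem_ofPred_eq, mem_preimage, ContinuousLinearMap.coe_coe, mem_ball_zero_iff, hS,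
      sub_eq_add_neg]
  have h2 : |LinearMap.det (S : EuclideanSpace ℝ (Fin n) →ₗ[ℝ] EuclideanSpace ℝ (Fin n))| =
    √(inducedMetric f u).det := hdet
  rw [hset, measure_preimage_add_right, Measure.addHaar_preimage_linearMap _ hne, abs_inv, h2,
    ← mul_assoc, ← ENNReal.ofReal_mul hpos.le, mul_inv_cancel₀ hpos.ne', ENNReal.ofReal_one, one_mul,
    Measure.addHaar_ball_of_pos _ _ hr, finrank_euclideanSpace_fin]

variable {M : Type*} [EMetricSpace M] [ChartedSpace (EuclideanSpace ℝ (Fin n)) M]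
  [IsManifold (𝓡 n) ∞ M] [RiemannianBundle (fun x : M => TangentSpace (𝓡 n) x)]
  {F : M → EuclideanSpace ℝ (Fin m)}

lemma lineMap_mem_ball {V : Type*} [NormedAddCommGroup V] [NormedSpace ℝ V] {u v w : V} {δ : ℝ}
    (hv : v ∈ Metric.ball u δ) (hw : w ∈ Metric.ball u δ) {t : ℝ} (ht : t ∈ Icc (0 : ℝ) 1) :
    AffineMap.lineMap v w t ∈ Metric.ball u δ :=
  (convex_ball u δ).lineMap_mem hv hw ht

lemma exists_ball_fderiv_le (hF : IsIsometricImmersion n F) {x : M}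
    {u : EuclideanSpace ℝ (Fin n)} (hu : u ∈ (extChartAt (𝓡 n) x).target) {ε : ℝ} (hε : 0 < ε) :
    ∃ δ > 0, ∀ v ∈ Metric.ball u δ, v ∈ (extChartAt (𝓡 n) x).target ∧
      ‖fderiv ℝ (localParam n F x) v - fderiv ℝ (localParam n F x) u‖ ≤ ε := by
  have hc : ContinuousAt (fderiv ℝ (localParam n F x)) u :=
    ((contDiffAt_localParam hF.1 hu).fderiv_right (m := ∞) (by simp)).continuousAt
  have h1 : ∀ᶠ v in 𝓝 u, v ∈ (extChartAt (𝓡 n) x).target ∧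
      ‖fderiv ℝ (localParam n F x) v - fderiv ℝ (localParam n F x) u‖ ≤ ε := by
    filter_upwards [(isOpen_extChartAt_target x).mem_nhds hu,
      hc (Metric.closedBall_mem_nhds _ hε)] with v h1 h2
    exact ⟨h1, by simpa [dist_eq_norm] using h2⟩
  obtain ⟨δ, hδ, h2⟩ := Metric.eventually_nhds_iff_ball.1 h1
  exact ⟨δ, hδ, h2⟩

variable [IsRiemannianManifold (𝓡 n) M]

lemma lipschitzNear_extChartAt_symm (hF : IsIsometricImmersion n F) {x : M}
    {u : EuclideanSpace ℝ (Fin n)} (hu : u ∈ (extChartAt (𝓡 n) x).target) :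
    LipschitzNear (extChartAt (𝓡 n) x).symm u := by
  obtain ⟨δ, hδ, h⟩ := exists_ball_fderiv_le hF hu one_pos
  set K := ‖fderiv ℝ (localParam n F x) u‖ + 1 with hK
  have hK0 : 0 ≤ K := by positivity
  refine ⟨K.toNNReal, Metric.ball u δ, Metric.ball_mem_nhds u hδ, fun v hv w hw => ?_⟩
  have h1 : edist ((extChartAt (𝓡 n) x).symm v) ((extChartAt (𝓡 n) x).symm w) ≤
      ENNReal.ofReal (K * ‖w - v‖) := by
    refine edist_extChartAt_symm_le hF fun t ht => ?_
    obtain ⟨h2, h3⟩ := h _ (lineMap_mem_ball hv hw ht)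
    refine ⟨h2, (ContinuousLinearMap.le_opNorm _ _).trans ?_⟩
    refine mul_le_mul_of_nonneg_right ?_ (norm_nonneg _)
    have := norm_sub_norm_le (fderiv ℝ (localParam n F x) (AffineMap.lineMap v w t))
      (fderiv ℝ (localParam n F x) u)
    linarith
  refine h1.trans_eq ?_
  rw [ENNReal.ofReal_mul hK0, edist_comm, edist_dist, dist_eq_norm]
  rfl

variable [MeasurableSpace M] [BorelSpace M]

/-- Small intrinsic balls have at least a fixed fraction of the Euclidean area. -/
lemma eventually_le_measure_eball (hF : IsIsometricImmersion n F) {ν : Measure M}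
    (hν : ∀ x, ν.restrict (extChartAt (𝓡 n) x).source = chartArea n F x) (p : M) :
    ∃ r₀ > 0, ∀ r, 0 < r → r < r₀ →
      ENNReal.ofReal (1 / 2 * (r / 2) ^ n) *
        volume (Metric.ball (0 : EuclideanSpace ℝ (Fin n)) 1) ≤
        ν (Metric.eball p (ENNReal.ofReal r)) := by
  set u := extChartAt (𝓡 n) p p with hu_def
  have hu : u ∈ (extChartAt (𝓡 n) p).target := mem_extChartAt_target p
  have hinj := hF.injective_fderiv_localParam p u hu
  set L := fderiv ℝ (localParam n F p) u with hL
  obtain ⟨K, hK0, hK⟩ := L.toLinearMap.exists_antilipschitzWith (LinearMap.ker_eq_bot.2 hinj)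
  have hK' : ∀ w, ‖w‖ ≤ K * ‖L w‖ := fun w => by
    simpa using hK.le_mul_dist w 0
  have hK0' : (0 : ℝ) < K := by exact_mod_cast hK0
  -- With error `K⁻¹`, and `‖w‖ ≤ K ‖L w‖`, lengths along segments from `u` are at most `2 ‖L (v -
  -- u)‖`; hence the `r / 2` in the conclusion. The `1 / 2` comes from the density being above half
  -- its value at `u`.
  obtain ⟨δ₁, hδ₁, h1⟩ := exists_ball_fderiv_le hF hu (inv_pos.2 hK0')
  set d := chartDensity n F p u with hd
  have hd0 : 0 < d := Real.sqrt_pos.2 (inducedMetric_det_pos hinj)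
  have hdc : ContinuousAt (chartDensity n F p) u :=
    (contDiffAt_sqrt_det (contDiffAt_localParam hF.1 hu) hinj).continuousAt
  obtain ⟨δ₂, hδ₂, h2⟩ := Metric.eventually_nhds_iff_ball.1
    (hdc.eventually (lt_mem_nhds (half_lt_self hd0)))
  refine ⟨min δ₁ δ₂ / K, by positivity, fun r hr hr0 => ?_⟩
  rw [lt_div_iff₀ hK0'] at hr0
  set E := {v | ‖L (v - u)‖ < r / 2} with hE
  have hball : ∀ v ∈ E, v ∈ Metric.ball u (min δ₁ δ₂) := by
    intro v hv
    rw [Metric.mem_ball, dist_eq_norm]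
    have h3 := hK' (v - u)
    have h4 : ‖L (v - u)‖ < r / 2 := hv
    have h5 := mul_lt_mul_of_pos_left h4 hK0'
    linarith [mul_pos hK0' hr, mul_comm r (K : ℝ)]
  have hEsub : E ⊆ (extChartAt (𝓡 n) p).symm ⁻¹' (Metric.eball p (ENNReal.ofReal r)) ∩
      (extChartAt (𝓡 n) p).target := by
    intro v hv
    have hvb := Metric.ball_subset_ball (min_le_left δ₁ δ₂) (hball v hv)
    refine ⟨?_, (h1 v hvb).1⟩
    have h3 : edist ((extChartAt (𝓡 n) p).symm u) ((extChartAt (𝓡 n) p).symm v) ≤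
        ENNReal.ofReal (2 * ‖L (v - u)‖) := by
      refine edist_extChartAt_symm_le hF fun t ht => ?_
      obtain ⟨h4, h5⟩ := h1 _ (lineMap_mem_ball (Metric.mem_ball_self hδ₁) hvb ht)
      refine ⟨h4, ?_⟩
      have h6 := (ContinuousLinearMap.le_opNorm (fderiv ℝ (localParam n F p)
        (AffineMap.lineMap u v t) - L) (v - u)).trans
        (mul_le_mul h5 (hK' (v - u)) (norm_nonneg _) (inv_nonneg.2 hK0'.le))
      rw [inv_mul_cancel_left₀ hK0'.ne', sub_apply] at h6
      have h7 := norm_sub_norm_le (fderiv ℝ (localParam n F p) (AffineMap.lineMap u v t) (v - u))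
        (L (v - u))
      linarith
    rw [hu_def, extChartAt_to_inv] at h3
    rw [mem_preimage, Metric.mem_eball, edist_comm]
    refine h3.trans_lt ((ENNReal.ofReal_lt_ofReal_iff hr).2 ?_)
    have h4 : ‖L (v - u)‖ < r / 2 := hv
    linarith
  have hEm : MeasurableSet E := by
    have : Continuous fun v => ‖L (v - u)‖ := by fun_prop
    exact measurableSet_lt this.measurable measurable_const
  calc ENNReal.ofReal (1 / 2 * (r / 2) ^ n) *
        volume (Metric.ball (0 : EuclideanSpace ℝ (Fin n)) 1)
      = ENNReal.ofReal (1 / 2) * (ENNReal.ofReal d * volume E) := by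
        rw [ENNReal.ofReal_mul (by norm_num), mul_assoc]
        congr 1
        exact (volume_ellipsoid hinj (by positivity)).symm
    _ = ∫⁻ _ in E, ENNReal.ofReal (d / 2) := by
        rw [setLIntegral_const, ← mul_assoc, ← ENNReal.ofReal_mul (by norm_num)]
        congr 2
        ring
    _ ≤ ∫⁻ v in E, ENNReal.ofReal (chartDensity n F p v) :=
        setLIntegral_mono' hEm fun v hv => ENNReal.ofReal_le_ofReal
          (h2 v (Metric.ball_subset_ball (min_le_right _ _) (hball v hv))).le
    _ ≤ ∫⁻ v in (extChartAt (𝓡 n) p).symm ⁻¹' (Metric.eball p (ENNReal.ofReal r)) ∩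
          (extChartAt (𝓡 n) p).target, ENNReal.ofReal (chartDensity n F p v) :=
        lintegral_mono_set hEsub
    _ = chartArea n F p (Metric.eball p (ENNReal.ofReal r)) :=
        (chartArea_apply p Metric.isOpen_eball.measurableSet).symm
    _ ≤ ν (Metric.eball p (ENNReal.ofReal r)) := by
        rw [← hν p]
        exact Measure.restrict_apply_le _ _

end LowerDensity

/-! ### The cutoff function and the pointwise monotonicity inequality. -/

section Monotonicity

variable {n m : ℕ} {M : Type*} [EMetricSpace M]

/-- The distance to `p`, truncated at `R`. -/
def truncDist (p : M) (R : ℝ) (q : M) : ℝ := (min (edist p q) (ENNReal.ofReal R)).toReal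

lemma truncDist_nonneg (p : M) (R : ℝ) (q : M) : 0 ≤ truncDist p R q := ENNReal.toReal_nonneg

/-- The truncation precedes `toReal` because `⊤.toReal = 0`: otherwise the distance would vanish on
other components and the cutoff would not be supported in a ball. -/
lemma lipschitzWith_truncDist (p : M) (R : ℝ) : LipschitzWith 1 (truncDist p R) := by
  have hne : ∀ q : M, min (edist p q) (ENNReal.ofReal R) ≠ ⊤ := fun q =>
    ((min_le_right _ _).trans_lt ENNReal.ofReal_lt_top).ne
  have key : ∀ q q' : M, edist q q' ≠ ⊤ →
      truncDist p R q ≤ truncDist p R q' + (edist q q').toReal := by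
    intro q q' h
    rw [truncDist, truncDist, ← ENNReal.toReal_add (hne _) h]
    refine ENNReal.toReal_mono (ENNReal.add_ne_top.2 ⟨hne _, h⟩) ?_
    rw [← min_add_add_right]
    refine min_le_min ?_ le_self_add
    rw [edist_comm q q']
    exact edist_triangle p q' q
  intro q q'
  rw [ENNReal.coe_one, one_mul]
  by_cases h : edist q q' = ⊤
  · rw [h]; exact le_top
  rw [edist_dist (truncDist p R q), Real.dist_eq, ENNReal.ofReal_le_iff_le_toReal h, abs_sub_le_iff]
  have h1 := key q q' h
  have h2 := key q' q (by rwa [edist_comm])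
  rw [edist_comm q' q] at h2
  constructor <;> linarith

lemma edist_eq_of_truncDist_lt {p q : M} {R : ℝ} (h : truncDist p R q < R) :
    edist p q = ENNReal.ofReal (truncDist p R q) := by
  have hR : 0 ≤ R := (truncDist_nonneg p R q).trans h.le
  rcases le_total (edist p q) (ENNReal.ofReal R) with h1 | h1
  · rw [truncDist, min_eq_left h1, ENNReal.ofReal_toReal (h1.trans_lt ENNReal.ofReal_lt_top).ne]
  · rw [truncDist, min_eq_right h1, ENNReal.toReal_ofReal hR] at h
    exact absurd h (lt_irrefl _)

lemma truncDist_le_of_edist_le {p q : M} {R s : ℝ} (hs : 0 ≤ s) (h : edist p q ≤ ENNReal.ofReal s) :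
    truncDist p R q ≤ s := by
  rw [← ENNReal.toReal_ofReal hs]
  exact ENNReal.toReal_mono ENNReal.ofReal_ne_top ((min_le_left _ _).trans h)

lemma mem_closedEBall_of_truncDist_lt {p q : M} {R s : ℝ} (hs : s ≤ R) (h : truncDist p R q < s) :
    q ∈ Metric.closedEBall p (ENNReal.ofReal s) := by
  rw [Metric.mem_closedEBall, edist_comm, edist_eq_of_truncDist_lt (h.trans_le hs)]
  exact ENNReal.ofReal_le_ofReal h.le

/-- The square makes the cutoff `C¹` at the edge of its support, so it is differentiable wherever
the distance is. -/
lemma hasDerivAt_max_zero_sq (x : ℝ) : HasDerivAt (fun x : ℝ => max x 0 ^ 2) (2 * max x 0) x := by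
  rcases lt_trichotomy x 0 with h | rfl | h
  · rw [max_eq_right h.le, mul_zero]
    refine (hasDerivAt_const x (0 : ℝ)).congr_of_eventuallyEq ?_
    filter_upwards [gt_mem_nhds h] with y hy
    rw [max_eq_right hy.le]; norm_num
  · rw [max_self, mul_zero, hasDerivAt_iff_isLittleO_nhds_zero]
    simp only [zero_add, max_self, smul_zero, sub_zero, ne_eq, OfNat.ofNat_ne_zero,
      not_false_eq_true, zero_pow]
    refine Asymptotics.IsBigO.trans_isLittleO (g := fun h : ℝ => h ^ 2) ?_ ?_
    · refine Asymptotics.IsBigO.of_bound 1 (Filter.Eventually.of_forall fun h => ?_)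
      rw [one_mul, norm_pow, norm_pow]
      refine pow_le_pow_left₀ (norm_nonneg _) ?_ 2
      rw [Real.norm_eq_abs, Real.norm_eq_abs, abs_of_nonneg (le_max_right _ _)]
      exact max_le (le_abs_self h) (abs_nonneg h)
    · simpa using Asymptotics.isLittleO_pow_pow (𝕜 := ℝ) (one_lt_two)
  · rw [max_eq_left h.le]
    have h1 : HasDerivAt (fun y : ℝ => y ^ 2) (2 * x) x := by simpa using hasDerivAt_pow 2 x
    refine h1.congr_of_eventuallyEq ?_
    filter_upwards [lt_mem_nhds h] with y hy
    rw [max_eq_left hy.le]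

variable [ChartedSpace (EuclideanSpace ℝ (Fin n)) M]
  [IsManifold (𝓡 n) ∞ M] [RiemannianBundle (fun x : M => TangentSpace (𝓡 n) x)]
  [IsRiemannianManifold (𝓡 n) M] {F : M → EuclideanSpace ℝ (Fin m)}

/-- A `1`-Lipschitz function on the manifold has gradient at most `1`. -/
lemma abs_fderiv_le_of_lipschitzWith (hF : IsIsometricImmersion n F) {ρ : M → ℝ}
    (hρ : LipschitzWith 1 ρ) {x : M} {u : EuclideanSpace ℝ (Fin n)}
    (hu : u ∈ (extChartAt (𝓡 n) x).target)
    (hd : DifferentiableAt ℝ (fun u => ρ ((extChartAt (𝓡 n) x).symm u)) u)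
    (v : EuclideanSpace ℝ (Fin n)) :
    |fderiv ℝ (fun u => ρ ((extChartAt (𝓡 n) x).symm u)) u v| ≤
      ‖fderiv ℝ (localParam n F x) u v‖ := by
  refine le_of_forall_pos_le_add fun ε hε => ?_
  obtain ⟨δ, hδ, h⟩ := exists_ball_fderiv_le hF hu (show 0 < ε / (‖v‖ + 1) by positivity)
  have hline : HasDerivAt (fun t : ℝ => ρ ((extChartAt (𝓡 n) x).symm (u + t • v)))
    (fderiv ℝ (fun u => ρ ((extChartAt (𝓡 n) x).symm u)) u v) 0 := hd.hasFDerivAt.hasLineDerivAt v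
  have hC : 0 ≤ ‖fderiv ℝ (localParam n F x) u v‖ + ε := by positivity
  have hev : ∀ᶠ t : ℝ in 𝓝 0, u + t • v ∈ Metric.ball u δ := by
    have hc : ContinuousAt (fun t : ℝ => u + t • v) 0 := by fun_prop
    exact hc (by simpa using Metric.ball_mem_nhds u hδ)
  have := hline.hasFDerivAt.le_of_lip' hC (by
    filter_upwards [hev] with t ht
    have h1 : edist ((extChartAt (𝓡 n) x).symm u) ((extChartAt (𝓡 n) x).symm (u + t • v)) ≤
        ENNReal.ofReal ((‖fderiv ℝ (localParam n F x) u v‖ + ε) * |t|) := by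
      refine edist_extChartAt_symm_le hF fun τ hτ => ?_
      obtain ⟨h2, h3⟩ := h _ (lineMap_mem_ball (Metric.mem_ball_self hδ) ht hτ)
      refine ⟨h2, ?_⟩
      rw [add_sub_cancel_left, map_smul, norm_smul, Real.norm_eq_abs, mul_comm]
      refine mul_le_mul_of_nonneg_right ?_ (abs_nonneg t)
      have h4 := (ContinuousLinearMap.le_opNorm (fderiv ℝ (localParam n F x)
        (AffineMap.lineMap u (u + t • v) τ) - fderiv ℝ (localParam n F x) u) v).trans
        (mul_le_mul_of_nonneg_right h3 (norm_nonneg _))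
      rw [sub_apply] at h4
      have h5 := norm_sub_norm_le (fderiv ℝ (localParam n F x)
        (AffineMap.lineMap u (u + t • v) τ) v) (fderiv ℝ (localParam n F x) u v)
      have h6 : ε / (‖v‖ + 1) * ‖v‖ ≤ ε := by
        rw [div_mul_eq_mul_div, div_le_iff₀ (by positivity)]
        nlinarith [norm_nonneg v]
      linarith
    have h2 := (hρ ((extChartAt (𝓡 n) x).symm (u + t • v)) ((extChartAt (𝓡 n) x).symm u))
    rw [ENNReal.coe_one, one_mul, edist_comm ((extChartAt (𝓡 n) x).symm (u + t • v)),
      edist_dist, dist_eq_norm] at h2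
    have h3 := (ENNReal.ofReal_le_ofReal_iff (by positivity)).1 (h2.trans h1)
    simpa using h3)
  rw [ContinuousLinearMap.norm_toSpanSingleton, Real.norm_eq_abs] at this
  exact this

lemma chartLipschitz_of_lipschitzWith (hF : IsIsometricImmersion n F) {ρ : M → ℝ}
    (hρ : LipschitzWith 1 ρ) : ChartLipschitz n ρ := fun _ _ hu =>
  LipschitzNear.comp (lipschitzNear_of_lipschitzWith hρ _) (lipschitzNear_extChartAt_symm hF hu)

lemma chartLipschitz_max_sq (hF : IsIsometricImmersion n F) {ρ : M → ℝ}
    (hρ : LipschitzWith 1 ρ) (s : ℝ) : ChartLipschitz n fun q => max (s - ρ q) 0 ^ 2 := by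
  intro x u hu
  have h1 : LipschitzWith 1 fun q => max (s - ρ q) 0 := by
    have h2 : LipschitzWith 1 fun q => s - ρ q := by
      simpa using (LipschitzWith.const s).sub hρ
    exact h2.max_const 0
  have h3 := chartLipschitz_of_lipschitzWith hF h1 x u hu
  refine (h3.mul h3).congr (Filter.Eventually.of_forall fun v => ?_)
  exact pow_two _

/-- Where the cutoff `μ` is positive, the position vector is no longer than `ρ < s`, so the
curvature term costs at most `C s μ²` and the gradient term at most `2 μ ρ`. -/
lemma le_firstVariation (hF : IsIsometricImmersion n F) {C : ℝ} (hC : 0 < C)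
    (hH : ∀ x : M, ‖meanCurvature n F x‖ ≤ C) {p q : M} {R s : ℝ} (hs : s ≤ R)
    (hd : ChartDifferentiableAt n (truncDist p R) q) :
    (n + 2 - C * s) * max (s - truncDist p R q) 0 ^ 2 - 2 * s * max (s - truncDist p R q) 0 ≤
      firstVariation n F (F p) (fun q => max (s - truncDist p R q) 0 ^ 2) q := by
  set φ := extChartAt (𝓡 n) q with hφ
  have hu : φ q ∈ φ.target := mem_extChartAt_target q
  have hinj := hF.injective_fderiv_localParam q _ hu
  have hval : localParam n F q (φ q) = F q := by rw [localParam, extChartAt_to_inv]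
  set g : EuclideanSpace ℝ (Fin n) → ℝ := fun u => truncDist p R (φ.symm u) with hg
  have hgq : g (φ q) = truncDist p R q := by rw [hg, hφ]; simp only [extChartAt_to_inv]
  have hdg : DifferentiableAt ℝ g (φ q) := hd
  have hder : HasFDerivAt (fun u => max (s - g u) 0 ^ 2)
      ((2 * max (s - g (φ q)) 0) • -fderiv ℝ g (φ q)) (φ q) := by
    have h1 := (hasDerivAt_max_zero_sq (s - g (φ q))).comp_hasFDerivAt (φ q)
      (hdg.hasFDerivAt.const_sub s)
    exact h1
  set ξ := tangentCoord (localParam n F q) (φ q) (F q - F p) with hξ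
  have hfv : firstVariation n F (F p) (fun q => max (s - truncDist p R q) 0 ^ 2) q =
      (n + inner ℝ (meanCurvature n F q) (F q - F p)) * max (s - truncDist p R q) 0 ^ 2 -
        2 * max (s - truncDist p R q) 0 * fderiv ℝ g (φ q) ξ := by
    have h1 := hder.fderiv
    rw [firstVariation, divIntegrand, ← hφ, hval, ← hξ, h1]
    simp only [smul_apply, neg_apply, smul_eq_mul]
    rw [← hgq]
    simp only [meanCurvature, hg, ← hφ]
    ring
  rw [hfv]
  set μ := max (s - truncDist p R q) 0 with hμ
  rcases (le_max_right (s - truncDist p R q) 0).eq_or_lt with h0 | h0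
  · rw [← hμ] at h0
    rw [← h0]; simp
  · have hpos : 0 < s - truncDist p R q := by
      rcases lt_max_iff.1 h0 with h | h
      · exact h
      · exact absurd h (lt_irrefl _)
    have hμe : μ = s - truncDist p R q := max_eq_left hpos.le
    have hX : ‖F q - F p‖ ≤ truncDist p R q := by
      have h1 := hF.lipschitzWith q p
      rw [ENNReal.coe_one, one_mul, edist_comm q p,
        edist_eq_of_truncDist_lt (by linarith : truncDist p R q < R), edist_dist, dist_eq_norm] at h1
      exact (ENNReal.ofReal_le_ofReal_iff (truncDist_nonneg _ _ _)).1 h1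
    have hgrad : fderiv ℝ g (φ q) ξ ≤ truncDist p R q :=
      (le_abs_self _).trans ((abs_fderiv_le_of_lipschitzWith hF (lipschitzWith_truncDist p R) hu hdg
        ξ).trans ((norm_fderiv_tangentCoord_le hinj _).trans hX))
    have hHX : -(C * s) ≤ inner ℝ (meanCurvature n F q) (F q - F p) := by
      have h1 := abs_real_inner_le_norm (meanCurvature n F q) (F q - F p)
      have h2 : ‖meanCurvature n F q‖ * ‖F q - F p‖ ≤ C * s :=
        mul_le_mul (hH q) (hX.trans (by linarith)) (norm_nonneg _) hC.le
      linarith [neg_abs_le (inner ℝ (meanCurvature n F q) (F q - F p))]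
    have hμpos : 0 < μ := h0
    -- Then `-2 μ ρ = 2 μ² - 2 s μ`, which is where `n + 2` comes from.
    have e1 : truncDist p R q = s - μ := by linarith
    rw [e1] at hgrad
    nlinarith [mul_le_mul_of_nonneg_left hgrad hμpos.le,
      mul_le_mul_of_nonneg_right hHX (sq_nonneg μ)]

end Monotonicity

/-! ### The differential inequality and the uniform lower area bound. -/

section AreaLowerBound

variable {n m : ℕ} {M : Type*} [EMetricSpace M] [MeasurableSpace M] [BorelSpace M]

lemma integrable_comp_truncDist {ν : Measure M} {p : M} {R : ℝ}
    (hfin : ν (Metric.closedEBall p (ENNReal.ofReal R)) < ⊤) {g : ℝ → ℝ} (hg : Continuous g)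
    (hg0 : ∀ x, R ≤ x → g x = 0) : Integrable (fun q => g (truncDist p R q)) ν := by
  have hcont : Continuous fun q => g (truncDist p R q) :=
    hg.comp (lipschitzWith_truncDist p R).continuous
  obtain ⟨B, hB⟩ := isCompact_Icc.exists_bound_of_continuousOn (hg.continuousOn (s := Icc 0 R))
  have hon : IntegrableOn (fun q => g (truncDist p R q))
      (Metric.closedEBall p (ENNReal.ofReal R)) ν := by
    refine Measure.integrableOn_of_bounded (M := max B 0) hfin.ne hcont.aestronglyMeasurable ?_
    filter_upwards [ae_restrict_mem Metric.isClosed_closedEBall.measurableSet] with q hq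
    rcases le_total 0 R with hR | hR
    · refine (hB _ ⟨truncDist_nonneg _ _ _, truncDist_le_of_edist_le hR ?_⟩).trans (le_max_left _ _)
      rw [edist_comm]; exact hq
    · rw [hg0 _ (hR.trans (truncDist_nonneg _ _ _)), norm_zero]
      exact le_max_right _ _
  refine (integrableOn_iff_integrable_of_support_subset fun q hq => ?_).1 hon
  refine mem_closedEBall_of_truncDist_lt le_rfl ?_
  by_contra! h
  exact hq (hg0 _ h)

variable [ChartedSpace (EuclideanSpace ℝ (Fin n)) M]
  [IsManifold (𝓡 n) ∞ M] [RiemannianBundle (fun x : M => TangentSpace (𝓡 n) x)]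
  [IsRiemannianManifold (𝓡 n) M] [SecondCountableTopology M] {F : M → EuclideanSpace ℝ (Fin m)}

/-- Integrates `le_firstVariation` against the vanishing first variation. For `0 < s < R` the right
side is `s J' s` with `J s = ∫ μ²`, by `hasDerivAt_integral_max_sq`. -/
lemma le_two_mul_integral (hF : IsIsometricImmersion n F) {C : ℝ} (hC : 0 < C)
    (hH : ∀ x : M, ‖meanCurvature n F x‖ ≤ C) {ν : Measure M}
    (hν : ∀ x, ν.restrict (extChartAt (𝓡 n) x).source = chartArea n F x) {p : M} {R s : ℝ}
    (hcomp : IsCompact (Metric.closedEBall p (ENNReal.ofReal R)))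
    (hfin : ν (Metric.closedEBall p (ENNReal.ofReal R)) < ⊤) (hs : s ≤ R) :
    (n + 2 - C * s) * ∫ q, max (s - truncDist p R q) 0 ^ 2 ∂ν ≤
      2 * s * ∫ q, max (s - truncDist p R q) 0 ∂ν := by
  have hρ := lipschitzWith_truncDist p R
  have hη := chartLipschitz_max_sq hF hρ s
  have hsupp : HasCompactSupport fun q => max (s - truncDist p R q) 0 ^ 2 := by
    refine hcomp.of_isClosed_subset (isClosed_tsupport _)
      (closure_minimal (fun q hq => ?_) Metric.isClosed_closedEBall)
    refine mem_closedEBall_of_truncDist_lt le_rfl ?_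
    by_contra! h
    exact hq (by simp only; rw [max_eq_right (by linarith)]; norm_num)
  obtain ⟨hint, hzero⟩ := integral_firstVariation hF.1 hF.injective_fderiv_localParam hν hη hsupp
    (F p)
  have hi1 : Integrable (fun q => max (s - truncDist p R q) 0 ^ 2) ν :=
    integrable_comp_truncDist hfin (g := fun x => max (s - x) 0 ^ 2) (by fun_prop) fun x hx => by
      rw [max_eq_right (by linarith)]; norm_num
  have hi2 : Integrable (fun q => max (s - truncDist p R q) 0) ν :=
    integrable_comp_truncDist hfin (g := fun x => max (s - x) 0) (by fun_prop) fun x hx =>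
      max_eq_right (by linarith)
  have hle : ∫ q, ((n + 2 - C * s) * max (s - truncDist p R q) 0 ^ 2 -
      2 * s * max (s - truncDist p R q) 0) ∂ν ≤
      ∫ q, firstVariation n F (F p) (fun q => max (s - truncDist p R q) 0 ^ 2) q ∂ν := by
    refine integral_mono_ae ((hi1.const_mul _).sub (hi2.const_mul _)) hint ?_
    filter_upwards [ae_chartDifferentiableAt hν (chartLipschitz_of_lipschitzWith hF hρ)] with q hq
    exact le_firstVariation hF hC hH hs hq
  rw [hzero, integral_sub (hi1.const_mul _) (hi2.const_mul _), integral_const_mul,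
    integral_const_mul] at hle
  linarith

omit [SecondCountableTopology M] [ChartedSpace (EuclideanSpace ℝ (Fin n)) M]
  [IsManifold (𝓡 n) ∞ M] [RiemannianBundle (fun x : M => TangentSpace (𝓡 n) x)]
  [IsRiemannianManifold (𝓡 n) M] in
lemma hasDerivAt_integral_max_sq {ν : Measure M} {p : M} {R s : ℝ}
    (hfin : ν (Metric.closedEBall p (ENNReal.ofReal R)) < ⊤) (hs0 : 0 < s) (hs : s < R) :
    HasDerivAt (fun s => ∫ q, max (s - truncDist p R q) 0 ^ 2 ∂ν)
      (2 * ∫ q, max (s - truncDist p R q) 0 ∂ν) s := by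
  have hρ : Continuous (truncDist p R) := (lipschitzWith_truncDist p R).continuous
  have h := hasDerivAt_integral_of_dominated_loc_of_deriv_le (μ := ν) (x₀ := s) (s := Ioo 0 R)
    (F := fun s q => max (s - truncDist p R q) 0 ^ 2)
    (F' := fun s q => 2 * max (s - truncDist p R q) 0)
    (bound := fun q => 2 * max (R - truncDist p R q) 0) (Ioo_mem_nhds hs0 hs)
    (Filter.Eventually.of_forall fun t => by
      have : Continuous fun q => max (t - truncDist p R q) 0 ^ 2 := by fun_prop
      exact this.aestronglyMeasurable)
    (integrable_comp_truncDist hfin (g := fun x => max (s - x) 0 ^ 2) (by fun_prop) fun x hx => by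
      rw [max_eq_right (by linarith)]; norm_num)
    (by
      have : Continuous fun q => 2 * max (s - truncDist p R q) 0 := by fun_prop
      exact this.aestronglyMeasurable)
    (Filter.Eventually.of_forall fun q t ht => by
      rw [Real.norm_eq_abs, abs_of_nonneg (by positivity)]
      have := max_le_max_right 0 (sub_le_sub_right ht.2.le (truncDist p R q))
      linarith)
    ((integrable_comp_truncDist hfin (g := fun x => max (R - x) 0) (by fun_prop) fun x hx =>
      max_eq_right (by linarith)).const_mul 2)
    (Filter.Eventually.of_forall fun q t _ => by
      have := (hasDerivAt_max_zero_sq (t - truncDist p R q)).comp t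
        ((hasDerivAt_id t).sub_const (truncDist p R q))
      rw [mul_one] at this
      exact this)
  rw [← integral_const_mul]
  exact h.2

/-- **Monotonicity**: intrinsic balls of radius `R` have area bounded below, uniformly in the
center. -/
theorem exists_le_measure_closedEBall (hF : IsIsometricImmersion n F) {C : ℝ} (hC : 0 < C)
    (hH : ∀ x : M, ‖meanCurvature n F x‖ ≤ C) {ν : Measure M}
    (hν : ∀ x, ν.restrict (extChartAt (𝓡 n) x).source = chartArea n F x) {R : ℝ} (hR : 0 < R)
    (hcomp : ∀ p : M, IsCompact (Metric.closedEBall p (ENNReal.ofReal R)))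
    (hfin : ∀ p : M, ν (Metric.closedEBall p (ENNReal.ofReal R)) < ⊤) :
    ∃ c : ℝ, 0 < c ∧ ∀ p : M, ENNReal.ofReal c ≤ ν (Metric.closedEBall p (ENNReal.ofReal R)) := by
  set β := (volume (Metric.ball (0 : EuclideanSpace ℝ (Fin n)) 1)).toReal with hβ
  have hβ0 : 0 < β := ENNReal.toReal_pos (Metric.measure_ball_pos _ _ one_pos).ne'
    measure_ball_lt_top.ne
  -- The density bound at radius `s / 2` gives `1 / 2 * (s / 4) ^ n * β`, and on that ball the
  -- cutoff is at least `s / 2`.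
  set c₁ := 1 / 2 * (1 / 4) ^ n * β * (1 / 2) ^ 2 with hc₁
  have hc₁0 : 0 < c₁ := by positivity
  set σ := R / 2 with hσ
  have hσ0 : 0 < σ := by positivity
  have hσR : σ < R := by linarith
  refine ⟨c₁ * σ ^ n * Real.exp (-(C * σ)), by positivity, fun p => ?_⟩
  set J : ℝ → ℝ := fun s => ∫ q, max (s - truncDist p R q) 0 ^ 2 ∂ν with hJ
  have hi : ∀ s ≤ R, Integrable (fun q => max (s - truncDist p R q) 0 ^ 2) ν := fun s hs =>
    integrable_comp_truncDist (hfin p) (g := fun x => max (s - x) 0 ^ 2) (by fun_prop) fun x hx => by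
      rw [max_eq_right (by linarith)]; norm_num
  set k : ℝ → ℝ := fun s => Real.exp (C * s) * J s / s ^ (n + 2) with hk
  have hkd : ∀ s ∈ Ioo 0 R, ∃ d, 0 ≤ d ∧ HasDerivAt k d s := by
    intro s hs
    have h1 := hasDerivAt_integral_max_sq (hfin p) hs.1 hs.2
    have h2 : HasDerivAt (fun s => Real.exp (C * s)) (Real.exp (C * s) * C) s := by
      simpa using ((hasDerivAt_id s).const_mul C).exp
    have h3 := (h2.mul h1).div (hasDerivAt_pow (n + 2) s) (pow_pos hs.1 _).ne'
    refine ⟨_, ?_, h3⟩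
    have h4 := le_two_mul_integral hF hC hH hν (hcomp p) (hfin p) hs.2.le
    refine div_nonneg ?_ (by positivity)
    have h5 : s ^ (n + 2) = s ^ (n + 1) * s := pow_succ s (n + 1)
    -- The numerator in the quotient rule is the slack of the differential inequality times this
    -- positive factor.
    have h6 : 0 ≤ Real.exp (C * s) * s ^ (n + 1) *
      (2 * s * ∫ q, max (s - truncDist p R q) 0 ∂ν -
        (n + 2 - C * s) * ∫ q, max (s - truncDist p R q) 0 ^ 2 ∂ν) :=
      mul_nonneg (mul_nonneg (Real.exp_pos _).le (pow_nonneg hs.1.le _)) (sub_nonneg.2 h4)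
    have h7 : n + 2 - 1 = n + 1 := rfl
    rw [h7, h5]
    push_cast
    simp only [Pi.mul_apply]
    linarith
  have hmono : MonotoneOn k (Ioo 0 R) := by
    choose! d hd using hkd
    refine monotoneOn_of_hasDerivWithinAt_nonneg (convex_Ioo 0 R)
      (fun s hs => (hd s hs).2.continuousAt.continuousWithinAt) (f' := d) ?_ ?_
    · intro s hs
      rw [interior_Ioo] at hs
      exact (hd s hs).2.hasDerivWithinAt
    · intro s hs
      rw [interior_Ioo] at hs
      exact (hd s hs).1
  obtain ⟨r₀, hr₀, hsmall⟩ := eventually_le_measure_eball hF hν p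
  -- The scale depends on `p`, but `c₁` does not; monotonicity carries the bound from `s` to the
  -- fixed radius `σ`.
  set s := min r₀ σ with hs
  have hs0 : 0 < s := lt_min hr₀ hσ0
  have hsR : s ≤ R := (min_le_right _ _).trans hσR.le
  have hballsub : Metric.eball p (ENNReal.ofReal (s / 2)) ⊆
      Metric.closedEBall p (ENNReal.ofReal R) :=
    Metric.eball_subset_closedEBall.trans
      (Metric.closedEBall_subset_closedEBall (ENNReal.ofReal_le_ofReal (by linarith)))
  have hballfin : ν (Metric.eball p (ENNReal.ofReal (s / 2))) < ⊤ :=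
    (measure_mono hballsub).trans_lt (hfin p)
  have hJs : c₁ * s ^ (n + 2) ≤ J s := by
    have h1 := hsmall (s / 2) (by positivity) ((half_lt_self hs0).trans_le (min_le_left _ _))
    have h2 : 1 / 2 * (s / 2 / 2) ^ n * β ≤
        (ν (Metric.eball p (ENNReal.ofReal (s / 2)))).toReal := by
      have := ENNReal.toReal_mono hballfin.ne h1
      rwa [ENNReal.toReal_mul, ENNReal.toReal_ofReal (by positivity)] at this
    have h3 : ∫ q, (Metric.eball p (ENNReal.ofReal (s / 2))).indicator (fun _ => (s / 2) ^ 2) q ∂ν ≤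
        J s := by
      refine integral_mono
        ((integrable_indicator_iff Metric.isOpen_eball.measurableSet).2
          (integrableOn_const hballfin.ne)) (hi s hsR) fun q => ?_
      by_cases hq : q ∈ Metric.eball p (ENNReal.ofReal (s / 2))
      · rw [indicator_of_mem hq]
        rw [Metric.mem_eball, edist_comm] at hq
        have h4 := truncDist_le_of_edist_le (R := R) (by positivity) hq.le
        exact pow_le_pow_left₀ (by positivity) (le_max_of_le_left (by linarith)) 2
      · rw [indicator_of_notMem hq]
        positivity
    rw [integral_indicator_const _ Metric.isOpen_eball.measurableSet, smul_eq_mul] at h3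
    refine le_trans ?_ h3
    calc c₁ * s ^ (n + 2) = 1 / 2 * (s / 2 / 2) ^ n * β * (s / 2) ^ 2 := by
          rw [hc₁, pow_add, show s / 2 / 2 = 1 / 4 * s by ring, mul_pow, div_pow s 2 2]
          ring
      _ ≤ _ := mul_le_mul_of_nonneg_right h2 (by positivity)
  have hks : c₁ ≤ k s := by
    rw [hk]
    simp only
    rw [le_div_iff₀ (by positivity)]
    have h1 : 1 ≤ Real.exp (C * s) := Real.one_le_exp (by positivity)
    have h2 : 0 ≤ J s := (by positivity : (0 : ℝ) ≤ c₁ * s ^ (n + 2)).trans hJs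
    nlinarith
  have hkσ : c₁ ≤ k σ := hks.trans (hmono ⟨hs0, (min_le_right _ _).trans_lt hσR⟩ ⟨hσ0, hσR⟩
    (min_le_right _ _))
  have hJσ : J σ ≤ (ν (Metric.closedEBall p (ENNReal.ofReal R))).toReal * σ ^ 2 := by
    have h1 : J σ ≤ ∫ q, (Metric.closedEBall p (ENNReal.ofReal R)).indicator
        (fun _ => σ ^ 2) q ∂ν := by
      refine integral_mono (hi σ hσR.le)
        ((integrable_indicator_iff Metric.isClosed_closedEBall.measurableSet).2
          (integrableOn_const (hfin p).ne)) fun q => ?_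
      by_cases hq : q ∈ Metric.closedEBall p (ENNReal.ofReal R)
      · rw [indicator_of_mem hq]
        exact pow_le_pow_left₀ (le_max_right _ _)
          (max_le (by linarith [truncDist_nonneg p R q]) hσ0.le) 2
      · have h4 : R ≤ truncDist p R q := by
          by_contra! h
          exact hq (mem_closedEBall_of_truncDist_lt le_rfl h)
        rw [indicator_of_notMem hq]
        simp only
        rw [max_eq_right (by linarith)]
        norm_num
    rwa [integral_indicator_const _ Metric.isClosed_closedEBall.measurableSet, smul_eq_mul] at h1
  rw [hk] at hkσ
  simp only at hkσ
  rw [le_div_iff₀ (by positivity)] at hkσ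
  refine ENNReal.ofReal_le_of_le_toReal ?_
  rw [Real.exp_neg, ← div_eq_mul_inv, div_le_iff₀ (Real.exp_pos _)]
  have h1 := hkσ.trans (mul_le_mul_of_nonneg_left hJσ (Real.exp_pos (C * σ)).le)
  rw [pow_add, ← mul_assoc, ← mul_assoc] at h1
  have h2 := le_of_mul_le_mul_right h1 (by positivity)
  linarith

end AreaLowerBound

/-! ### Finite area over bounded sets. -/

section FiniteArea

variable {n m : ℕ} {M : Type*} [TopologicalSpace M] [ChartedSpace (EuclideanSpace ℝ (Fin n)) M]
  [MeasurableSpace M] [BorelSpace M] {F : M → EuclideanSpace ℝ (Fin m)}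

/-- A single Gaussian, with centre `0` and scale `1`, suffices: its weight is at least `exp (-r ^ 2
/ 4)` on the ball. -/
lemma area_preimage_closedBall_lt_top (hF : Continuous F) (h : entropy n F < ⊤) (r : ℝ) :
    area n F (F ⁻¹' Metric.closedBall 0 r) < ⊤ := by
  have hg : gaussianArea n F 0 1 < ⊤ := by
    refine lt_of_le_of_lt ?_ h
    exact le_iSup_of_le 0 (le_iSup_of_le 1 (le_iSup_of_le one_pos le_rfl))
  -- Needed because `0 * ⊤ = 0` in `ℝ≥0∞`.
  have hcoef : ENNReal.ofReal ((4 * Real.pi * 1) ^ (-(n : ℝ) / 2)) ≠ 0 := by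
    rw [Ne, ENNReal.ofReal_eq_zero, not_le]
    positivity
  have hint : ∫⁻ p, ENNReal.ofReal (Real.exp (-‖F p - 0‖ ^ 2 / (4 * 1))) ∂(area n F) < ⊤ := by
    by_contra! htop
    rw [gaussianArea, top_le_iff.1 htop, ENNReal.mul_top hcoef] at hg
    exact lt_irrefl _ hg
  have hm : MeasurableSet (F ⁻¹' Metric.closedBall 0 r) :=
    (Metric.isClosed_closedBall.preimage hF).measurableSet
  have hle : ENNReal.ofReal (Real.exp (-r ^ 2 / 4)) * area n F (F ⁻¹' Metric.closedBall 0 r) ≤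
      ∫⁻ p, ENNReal.ofReal (Real.exp (-‖F p - 0‖ ^ 2 / (4 * 1))) ∂(area n F) := by
    rw [← setLIntegral_const]
    refine (setLIntegral_mono' hm fun p hp => ?_).trans (setLIntegral_le_lintegral _ _)
    refine ENNReal.ofReal_le_ofReal (Real.exp_le_exp.2 ?_)
    have h1 : ‖F p‖ ≤ r := by simpa using hp
    have h2 := pow_le_pow_left₀ (norm_nonneg _) h1 2
    rw [sub_zero, mul_one]
    linarith
  have hpos : ENNReal.ofReal (Real.exp (-r ^ 2 / 4)) ≠ 0 := by
    rw [Ne, ENNReal.ofReal_eq_zero, not_le]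
    exact Real.exp_pos _
  by_contra! htop
  rw [top_le_iff.1 htop, ENNReal.mul_top hpos, top_le_iff] at hle
  exact hint.ne hle

end FiniteArea

/-! ### Separated sequences. -/

section Separation

open NNReal

/-- Greedy choice of points not covered by the `ε`-balls about the earlier ones; taking `δ < ε`
makes the separation strict. -/
lemma exists_separated_seq {X : Type*} [PseudoEMetricSpace X] {s : Set X}
    (hs : ¬ TotallyBounded s) :
    ∃ δ : ℝ≥0, 0 < δ ∧ ∃ f : ℕ → X, (∀ i, f i ∈ s) ∧ ∀ i j, i ≠ j → (δ : ℝ≥0∞) < edist (f i) (f j) := by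
  rw [EMetric.totallyBounded_iff] at hs
  push Not at hs
  obtain ⟨ε, hε, h⟩ := hs
  obtain ⟨δ, hδ0, hδ⟩ := ENNReal.lt_iff_exists_nnreal_btwn.1 hε
  obtain ⟨f, hf, hsep⟩ := exists_seq_of_forall_finset_exists (fun x => x ∈ s)
    (fun x y => ε ≤ edist y x) fun t _ => by
      obtain ⟨y, hy, hyt⟩ := Set.not_subset.1 (h t t.finite_toSet)
      refine ⟨y, hy, fun x hx => ?_⟩
      by_contra! hlt
      exact hyt (mem_iUnion₂.2 ⟨x, hx, hlt⟩)
  refine ⟨δ, by exact_mod_cast hδ0, f, hf, fun i j hij => ?_⟩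
  rcases lt_or_gt_of_ne hij with h1 | h1
  · rw [edist_comm]; exact hδ.trans_le (hsep i j h1)
  · exact hδ.trans_le (hsep j i h1)

end Separation

end Immersed

end

/-! ### The packing argument. -/

theorem lemmaA3 (n k : ℕ) {M : Type*} [EMetricSpace M] [SecondCountableTopology M]
    [MeasurableSpace M] [BorelSpace M]
    [ChartedSpace (EuclideanSpace ℝ (Fin n)) M] [IsManifold (𝓡 n) ∞ M]
    [RiemannianBundle (fun x : M => TangentSpace (𝓡 n) x)]
    [IsContMDiffRiemannianBundle (𝓡 n) ∞ (EuclideanSpace ℝ (Fin n))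
      (fun x : M => TangentSpace (𝓡 n) x)]
    [IsRiemannianManifold (𝓡 n) M]
    [CompleteSpace M] [NoncompactSpace M]
    (horient : Immersed.IsOrientable n M)
    (F : M → EuclideanSpace ℝ (Fin (n + k)))
    (hF : Immersed.IsIsometricImmersion n F)
    (hentropy : Immersed.entropy n F < ⊤)
    (hH : ∃ C : ℝ, 0 < C ∧ ∀ x : M, ‖Immersed.meanCurvature n F x‖ ≤ C) :
    IsProperMap F := by
  obtain ⟨C, hC, hH⟩ := hH
  have : LocallyCompactSpace M := Manifold.locallyCompact_of_finiteDimensional (𝓡 n)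
  have hcomp : ∀ (p : M) (R : ℝ), IsCompact (Metric.closedEBall p (ENNReal.ofReal R)) :=
    fun p R => Immersed.isCompact_closedEBall_of_length
      (fun _ _ _ _ h1 h2 h => Immersed.exists_edist_lt_of_edist_lt_add n h h1 h2) p R.toNNReal
  have : Nonempty M := not_isEmpty_iff.1 fun _ => not_compactSpace_iff.2 ‹_› inferInstance
  obtain ⟨ν, hνle, hν⟩ := Immersed.exists_measure_le_area (n := n) hF.1
  have hνfin : ∀ r : ℝ, ν (F ⁻¹' Metric.closedBall 0 r) < ⊤ := fun r =>
    (hνle _).trans_lt (Immersed.area_preimage_closedBall_lt_top hF.1.continuous hentropy r)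
  have hball : ∀ (p : M) {R : ℝ}, 0 < R → Metric.closedEBall p (ENNReal.ofReal R) ⊆
      F ⁻¹' Metric.closedBall 0 (‖F p‖ + R) := by
    intro p R hR q hq
    have h1 := (hF.lipschitzWith q p).trans (by simpa using Metric.mem_closedEBall.1 hq)
    rw [edist_dist, ENNReal.ofReal_le_ofReal_iff hR.le, dist_eq_norm] at h1
    have h2 := norm_sub_norm_le (F q) (F p)
    rw [Set.mem_preimage, mem_closedBall_zero_iff]
    linarith
  refine isProperMap_iff_isCompact_preimage.2 ⟨hF.1.continuous, fun K hK => ?_⟩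
  -- The preimage is closed in a complete space, so only total boundedness is at stake.
  refine isCompact_iff_totallyBounded_isComplete.2
    ⟨?_, (hK.isClosed.preimage hF.1.continuous).isComplete⟩
  by_contra htb
  obtain ⟨δ, hδ, f, hfK, hsep⟩ := Immersed.exists_separated_seq htb
  have hR : 0 < (δ : ℝ) / 2 := by positivity
  obtain ⟨c, hc, hlow⟩ := Immersed.exists_le_measure_closedEBall hF hC hH hν hR
    (fun p => hcomp p _) fun p => (measure_mono (hball p hR)).trans_lt (hνfin _)
  obtain ⟨B, hB⟩ := hK.isBounded.exists_norm_le
  -- Closed balls of radius `δ / 2` are disjoint because the separation by `δ` is strict.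
  have hdisj : Pairwise (Function.onFun Disjoint fun i =>
      Metric.closedEBall (f i) (ENNReal.ofReal ((δ : ℝ) / 2))) := by
    intro i j hij
    refine Set.disjoint_left.2 fun q hqi hqj => not_lt.2 ?_ (hsep i j hij)
    calc edist (f i) (f j) ≤ edist (f i) q + edist q (f j) := edist_triangle _ _ _
      _ ≤ ENNReal.ofReal ((δ : ℝ) / 2) + ENNReal.ofReal ((δ : ℝ) / 2) :=
        add_le_add (by rw [edist_comm]; exact hqi) hqj
      _ = δ := by rw [← ENNReal.ofReal_add hR.le hR.le, add_halves, ENNReal.ofReal_coe_nnreal]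
  have hsub : (⋃ i, Metric.closedEBall (f i) (ENNReal.ofReal ((δ : ℝ) / 2))) ⊆
      F ⁻¹' Metric.closedBall 0 (B + (δ : ℝ) / 2) :=
    Set.iUnion_subset fun i => (hball (f i) hR).trans (Set.preimage_mono
      (Metric.closedBall_subset_closedBall (by linarith [hB _ (hfK i)])))
  have htop : ν (⋃ i, Metric.closedEBall (f i) (ENNReal.ofReal ((δ : ℝ) / 2))) = ⊤ := by
    rw [measure_iUnion hdisj fun i => Metric.isClosed_closedEBall.measurableSet, ← top_le_iff,
      ← ENNReal.tsum_const_eq_top_of_ne_zero (α := ℕ) (ENNReal.ofReal_pos.2 hc).ne']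
    exact ENNReal.tsum_le_tsum fun i => hlow (f i)
  exact ((measure_mono hsub).trans_lt (hνfin _)).ne htop
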